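/- Let $1\le p,q\le\infty$ with dual exponents $p',q'$ (that is, $\frac1p+\frac1{p'}=\frac1q+\frac1{q'}=1$, with $\frac1\infty=0$), and let $v>0$. Let $\psi:[-1,1]\to\mathbb{R}$ be a $C^2$ function with $|\psi''(\xi)|\ge v$ for all $\xi\in[-1,1]$. Let $\mathcal{M}^\psi=\{(\xi,\psi(\xi)):\xi\in[-1,1]\}\subset\mathbb{R}^2$ be its graph, with the measure $\sigma^\psi(A)=|P(A)|$ for Borel $A\subset\mathcal{M}^\psi$, where $P(\xi,\psi(\xi))=\xi$ and $|\cdot|$ is Lebesgue measure on $\mathbb{R}$. For $f\in L^1(\mathcal{M}^\psi,d\sigma^\psi)$ put \[ \mathcal{E}^\psi f(x_1,x_2)=\int_{\mathcal{M}^\psi} f(\xi,\psi(\xi))\,e^{2\pi i(x_1\xi+x_2\psi(\xi))}\,d\sigma^\psi(\xi,\psi(\xi)),\qquad (x_1,x_2)\in\mathbb{R}^2 . \] Say that $R^*_{\mathcal{M}^\psi}(q'\mapsto p')$ holds if there is a finite constant $C$ such that \[ \|\mathcal{E}^\psi f\|_{L^{p'}(\mathbb{R}^2)}\le C\,\|f\|_{L^{q'}(\mathcal{M}^\psi,d\sigma^\psi)}\qquad\text{for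 all } f\in L^{q'}(\mathcal{M}^\psi,d\sigma^\psi). \] Then $R^*_{\mathcal{M}^\psi}(q'\mapsto p')$ holds if and only if \[ p'>4\quad\text{and}\quad \frac{3}{p'}+\frac{1}{q'}\le 1 . \] Moreover, when these two conditions hold, the constant $C$ can be chosen to depend only on $p$, $q$ and $v$, and not otherwise on $\psi$. -/

import Mathlib

open MeasureTheory
open scoped ENNReal NNReal

noncomputable section

/-- The curve `{(ξ, ψ(ξ)) : ξ ∈ [-1,1]}` in the plane; only the values of `ψ` on `[-1,1]` matter. -/
def graphCurve (ψ : ℝ → ℝ) : Set (ℝ × ℝ) :=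
  (fun ξ : ℝ => (ξ, ψ ξ)) '' Set.Icc (-1) 1

/-- The canonical projection `(ξ, ψ(ξ)) ↦ ξ` of the curve to the line. -/
def curveProj (ψ : ℝ → ℝ) : graphCurve ψ → ℝ := fun m => m.1.1

/-- The pullback of Lebesgue measure under the projection: `σ(A) = |P(A)|` for Borel subsets `A` of
the curve. -/
def curveMeasure (ψ : ℝ → ℝ) : Measure (graphCurve ψ) :=
  Measure.comap (curveProj ψ) volume

/-- The extension operator
`E f(x₁, x₂) = ∫ f(ξ, ψ(ξ)) exp(2πi (x₁ ξ + x₂ ψ(ξ))) dσ(ξ, ψ(ξ))`. -/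
def extensionOp (ψ : ℝ → ℝ) (f : graphCurve ψ → ℂ) (x : ℝ × ℝ) : ℂ :=
  ∫ m : graphCurve ψ,
    f m * Complex.exp (2 * Real.pi * Complex.I * ((x.1 * m.1.1 + x.2 * m.1.2 : ℝ) : ℂ))
      ∂(curveMeasure ψ)

/-- The extension inequality `‖E f‖_{L^b(ℝ²)} ≤ C ‖f‖_{L^a(σ)}` for all `f ∈ L^a(σ)`. -/
def ExtensionBound (ψ : ℝ → ℝ) (a b : ℝ≥0∞) (C : ℝ≥0) : Prop :=
  ∀ f : graphCurve ψ → ℂ, MemLp f a (curveMeasure ψ) →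
    eLpNorm (extensionOp ψ f) b volume ≤ C * eLpNorm f a (curveMeasure ψ)

/-- The extension estimate `R*(a → b)` for the curve: the extension inequality holds with some
finite constant independent of `f`. -/
def ExtensionEstimate (ψ : ℝ → ℝ) (a b : ℝ≥0∞) : Prop :=
  ∃ C : ℝ≥0, ExtensionBound ψ a b C

/-- `ψ` is `C²` on `[-1,1]` (one-sided at the end points) and `|ψ''| ≥ v` there. -/
def CurvatureBoundedBelow (v : ℝ) (ψ : ℝ → ℝ) : Prop :=
  ContDiffOn ℝ 2 ψ (Set.Icc (-1) 1) ∧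
    ∀ ξ ∈ Set.Icc (-1 : ℝ) 1, v ≤ |iteratedDerivWithin 2 ψ (Set.Icc (-1) 1) ξ|

end

noncomputable section

/-! ### Plane waves and transfer from the curve to the interval -/

/-- The unimodular function `t ↦ exp (2πit)`. -/
def unitPhase (t : ℝ) : ℂ := Complex.exp (2 * Real.pi * Complex.I * (t : ℂ))

lemma norm_unitPhase (t : ℝ) : ‖unitPhase t‖ = 1 := by
  have : unitPhase t = Complex.exp (((2 * Real.pi * t : ℝ) : ℂ) * Complex.I) := by
    unfold unitPhase; congr 1; push_cast; ring
  rw [this, Complex.norm_exp_ofReal_mul_I]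

lemma unitPhase_add (s t : ℝ) : unitPhase (s + t) = unitPhase s * unitPhase t := by
  unfold unitPhase; rw [← Complex.exp_add]; congr 1; push_cast; ring

lemma conj_unitPhase (t : ℝ) : (starRingEnd ℂ) (unitPhase t) = unitPhase (-t) := by
  unfold unitPhase; rw [← Complex.exp_conj]; congr 1; simp [Complex.conj_ofNat]

@[fun_prop]
lemma continuous_unitPhase : Continuous unitPhase := by unfold unitPhase; fun_prop

@[fun_prop]
lemma measurable_unitPhase : Measurable unitPhase := continuous_unitPhase.measurable

lemma re_unitPhase (t : ℝ) : (unitPhase t).re = Real.cos (2 * Real.pi * t) := by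
  have : unitPhase t = Complex.exp (((2 * Real.pi * t : ℝ) : ℂ) * Complex.I) := by
    unfold unitPhase; congr 1; push_cast; ring
  rw [this, Complex.exp_ofReal_mul_I_re]

/-- Lebesgue measure on `[-1,1]`. -/
abbrev intervalMeasure : Measure ℝ := volume.restrict (Set.Icc (-1) 1)

/-- The extension operator in the coordinate `ξ` of the curve. -/
def intervalExtension (ψ : ℝ → ℝ) (g : ℝ → ℂ) (x : ℝ × ℝ) : ℂ :=
  ∫ ξ, g ξ * unitPhase (x.1 * ξ + x.2 * ψ ξ) ∂intervalMeasure

/-- The curve is compact, so the continuous injective projection is a closed embedding. This also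
guarantees that `Measure.comap` in `curveMeasure` does not take its default value zero. -/
lemma measurableEmbedding_curveProj {ψ : ℝ → ℝ} (hψ : ContinuousOn ψ (Set.Icc (-1) 1)) :
    MeasurableEmbedding (curveProj ψ) := by
  have hc : IsCompact (graphCurve ψ) :=
    isCompact_Icc.image_of_continuousOn (continuousOn_id.prodMk hψ)
  have : CompactSpace (graphCurve ψ) := isCompact_iff_compactSpace.mp hc
  refine (Continuous.isClosedEmbedding ?_ ?_).measurableEmbedding
  · unfold curveProj; fun_prop
  · rintro ⟨_, ξ, hξ, rfl⟩ ⟨_, η, hη, rfl⟩ h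
    simp only [curveProj] at h
    subst h; rfl

lemma map_curveProj {ψ : ℝ → ℝ} (hψ : ContinuousOn ψ (Set.Icc (-1) 1)) :
    (curveMeasure ψ).map (curveProj ψ) = intervalMeasure := by
  rw [curveMeasure, (measurableEmbedding_curveProj hψ).map_comap]
  congr 1
  ext ξ
  constructor
  · rintro ⟨⟨_, η, hη, rfl⟩, rfl⟩; exact hη
  · intro h; exact ⟨⟨(ξ, ψ ξ), ξ, h, rfl⟩, rfl⟩

lemma extensionOp_comp_curveProj {ψ : ℝ → ℝ} (hψ : ContinuousOn ψ (Set.Icc (-1) 1)) (g : ℝ → ℂ) :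
    extensionOp ψ (g ∘ curveProj ψ) = intervalExtension ψ g := by
  ext x
  rw [intervalExtension, ← map_curveProj hψ, (measurableEmbedding_curveProj hψ).integral_map]
  unfold extensionOp unitPhase
  congr 1
  ext ⟨_, ξ, hξ, rfl⟩
  simp [curveProj]

/-- The projection carries the curve measure to Lebesgue measure on the interval, and every function
on the curve is a pullback. All later work can thus be done in the coordinate ξ. -/
lemma extensionBound_iff {ψ : ℝ → ℝ} (hψ : ContinuousOn ψ (Set.Icc (-1) 1)) (a b : ℝ≥0∞)
    (C : ℝ≥0) : ExtensionBound ψ a b C ↔ ∀ g : ℝ → ℂ, MemLp g a intervalMeasure →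
      eLpNorm (intervalExtension ψ g) b volume ≤ C * eLpNorm g a intervalMeasure := by
  have hP := measurableEmbedding_curveProj hψ
  constructor
  · intro h g hg
    have := h (g ∘ curveProj ψ) (by rw [← hP.memLp_map_measure_iff, map_curveProj hψ]; exact hg)
    rwa [extensionOp_comp_curveProj hψ, ← hP.eLpNorm_map_measure, map_curveProj hψ] at this
  · intro h f hf
    obtain ⟨g, rfl⟩ : ∃ g : ℝ → ℂ, f = g ∘ curveProj ψ :=
      ⟨Function.extend (curveProj ψ) f 0, (funext fun m => hP.injective.extend_apply f 0 m).symm⟩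
    rw [extensionOp_comp_curveProj hψ, ← hP.eLpNorm_map_measure, map_curveProj hψ]
    apply h
    rwa [← map_curveProj hψ, hP.memLp_map_measure_iff]

lemma intervalExtension_congr_phase {ψ Ψ : ℝ → ℝ} (h : Set.EqOn ψ Ψ (Set.Icc (-1) 1))
    (g : ℝ → ℂ) : intervalExtension ψ g = intervalExtension Ψ g := by
  ext x
  refine setIntegral_congr_fun measurableSet_Icc fun ξ hξ => ?_
  simp only [h hξ]

lemma intervalExtension_congr_ae {ψ : ℝ → ℝ} {f g : ℝ → ℂ} (h : f =ᵐ[intervalMeasure] g) :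
    intervalExtension ψ f = intervalExtension ψ g := by
  ext x
  refine integral_congr_ae ?_
  filter_upwards [h] with ξ hξ
  rw [hξ]

/-! ### Extending the phase to the line -/

/-- A phase with curvature bounded below extends from `[-1,1]` to a `C¹` function on the line whose
derivative is bi-Lipschitz on `[-1,1]`. -/
lemma CurvatureBoundedBelow.exists_extension {v : ℝ} {ψ : ℝ → ℝ} (h : CurvatureBoundedBelow v ψ) :
    ∃ Ψ φ : ℝ → ℝ, Continuous φ ∧ (∀ x, HasDerivAt Ψ (φ x) x) ∧
      Set.EqOn ψ Ψ (Set.Icc (-1) 1) ∧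
      (∀ ξ ∈ Set.Icc (-1 : ℝ) 1, ∀ η ∈ Set.Icc (-1 : ℝ) 1, v * |ξ - η| ≤ |φ ξ - φ η|) ∧
      ∃ K : ℝ, 0 < K ∧ ∀ ξ ∈ Set.Icc (-1 : ℝ) 1, ∀ η ∈ Set.Icc (-1 : ℝ) 1,
        |φ ξ - φ η| ≤ K * |ξ - η| := by
  obtain ⟨hC, hv⟩ := h
  set I : Set ℝ := Set.Icc (-1) 1 with hI
  have huI : UniqueDiffOn ℝ I := uniqueDiffOn_Icc (by norm_num)
  set d : ℝ → ℝ := derivWithin ψ I with hd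
  have hd1 : ContDiffOn ℝ 1 d I :=
    ((contDiffOn_succ_iff_derivWithin (n := 1) huI).1 (by simpa using! hC)).2.2
  have hdd : DifferentiableOn ℝ d I := hd1.differentiableOn (by norm_num)
  have hψd : DifferentiableOn ℝ ψ I := hC.differentiableOn (by norm_num)
  have h2 : ∀ ξ, iteratedDerivWithin 2 ψ I ξ = derivWithin d I ξ := by
    intro ξ
    rw [show (2 : ℕ) = 1 + 1 from rfl, iteratedDerivWithin_succ]
    congr 1
    ext; rw [iteratedDerivWithin_one]
  have hd2 : ContinuousOn (derivWithin d I) I := hd1.continuousOn_derivWithin huI (by norm_num)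
  have hint : ∀ {f : ℝ → ℝ}, DifferentiableOn ℝ f I → ∀ x ∈ Set.Ioo (-1 : ℝ) 1,
      HasDerivAt f (derivWithin f I x) x := by
    intro f hf x hx
    have hx' : x ∈ I := Set.Ioo_subset_Icc_self hx
    exact (hf x hx').hasDerivWithinAt.hasDerivAt (Icc_mem_nhds hx.1 hx.2)
  obtain ⟨K, hK⟩ := isCompact_Icc.exists_bound_of_continuousOn hd2
  have hmvt : ∀ ξ ∈ I, ∀ η ∈ I, ξ < η → ∃ c ∈ I, d η - d ξ = derivWithin d I c * (η - ξ) := by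
    intro ξ hξ η hη hlt
    obtain ⟨c, hc, he⟩ := exists_hasDerivAt_eq_slope d (derivWithin d I) hlt
      (hd1.continuousOn.mono (Set.Icc_subset_Icc hξ.1 hη.2))
      (fun x hx => hint hdd x ⟨hξ.1.trans_lt hx.1, hx.2.trans_le hη.2⟩)
    refine ⟨c, ⟨hξ.1.trans hc.1.le, hc.2.le.trans hη.2⟩, ?_⟩
    rw [he, div_mul_cancel₀ _ (sub_pos.2 hlt).ne']
  -- An equality at an intermediate point serves both the lower bound `v` and the upper bound `K`,
  -- whatever the sign of the second derivative.
  have hmvt' : ∀ ξ ∈ I, ∀ η ∈ I, ∃ c ∈ I, |d ξ - d η| = |derivWithin d I c| * |ξ - η| := by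
    intro ξ hξ η hη
    rcases lt_trichotomy ξ η with hlt | rfl | hlt
    · obtain ⟨c, hc, he⟩ := hmvt ξ hξ η hη hlt
      exact ⟨c, hc, by rw [abs_sub_comm, he, abs_mul, abs_sub_comm ξ]⟩
    · exact ⟨ξ, hξ, by simp⟩
    · obtain ⟨c, hc, he⟩ := hmvt η hη ξ hξ hlt
      exact ⟨c, hc, by rw [he, abs_mul]⟩
  -- The derivative is frozen at its end-point values outside the interval. Its primitive is then
  -- differentiable on the whole line, which removes one-sided derivatives from later arguments.
  set φ : ℝ → ℝ := Set.IccExtend (by norm_num : (-1 : ℝ) ≤ 1) (I.domRestrict d) with hφ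
  have hφd : ∀ ξ ∈ I, φ ξ = d ξ := fun ξ hξ => by
    rw [hφ, Set.IccExtend_of_mem _ _ hξ]; rfl
  have hφc : Continuous φ := Continuous.Icc_extend' hd1.continuousOn.domRestrict
  have hΨ : ∀ x, HasDerivAt (fun y => ψ (-1) + ∫ t in (-1 : ℝ)..y, φ t) (φ x) x := fun x =>
    (intervalIntegral.integral_hasDerivAt_right (hφc.intervalIntegrable _ _)
      (hφc.stronglyMeasurableAtFilter _ _) hφc.continuousAt).const_add _
  refine ⟨_, φ, hφc, hΨ, ?_, ?_, ?_⟩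
  · intro x hx
    have : ∫ t in (-1 : ℝ)..x, φ t = ψ x - ψ (-1) := by
      refine intervalIntegral.integral_eq_sub_of_hasDerivAt_of_le hx.1
        (hψd.continuousOn.mono (Set.Icc_subset_Icc_right hx.2)) (fun t ht => ?_)
        (hφc.intervalIntegrable _ _)
      have ht' : t ∈ Set.Ioo (-1 : ℝ) 1 := ⟨ht.1, ht.2.trans_le hx.2⟩
      rw [hφd t (Set.Ioo_subset_Icc_self ht')]
      exact hint hψd t ht'
    simp [this]
  · intro ξ hξ η hη
    rw [hφd ξ hξ, hφd η hη]
    obtain ⟨c, hc, he⟩ := hmvt' ξ hξ η hη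
    rw [he, ← h2]
    exact mul_le_mul_of_nonneg_right (hv c hc) (abs_nonneg _)
  · refine ⟨max K 1, by positivity, fun ξ hξ η hη => ?_⟩
    rw [hφd ξ hξ, hφd η hη]
    obtain ⟨c, hc, he⟩ := hmvt' ξ hξ η hη
    rw [he]
    exact mul_le_mul_of_nonneg_right ((hK c hc).trans (le_max_left _ _)) (abs_nonneg _)

lemma CurvatureBoundedBelow.continuousOn {v : ℝ} {ψ : ℝ → ℝ} (h : CurvatureBoundedBelow v ψ) :
    ContinuousOn ψ (Set.Icc (-1) 1) := h.1.continuousOn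

/-! ### The L² bound by Gaussian regularization -/

/-- Expanding the weighted square mean of a superposition of bounded functions. -/
lemma integral_mul_norm_sq_superposition {Ω X : Type*} [MeasurableSpace Ω] [MeasurableSpace X]
    {μ : Measure Ω} [SFinite μ] {ν : Measure X} [SFinite ν] {h : Ω → ℂ} (hh : Integrable h μ)
    {k : X → ℝ} (hk : Integrable k ν) {a : X → Ω → ℂ} (ha : Measurable (Function.uncurry a))
    (ha1 : ∀ x z, ‖a x z‖ = 1) :
    ((∫ x, k x * ‖∫ z, h z * a x z ∂μ‖ ^ 2 ∂ν : ℝ) : ℂ) =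
      ∫ z : Ω × Ω, h z.1 * (starRingEnd ℂ) (h z.2) *
        (∫ x, (k x : ℂ) * (a x z.1 * (starRingEnd ℂ) (a x z.2)) ∂ν) ∂(μ.prod μ) := by
  have h1 : ∀ x, ((k x * ‖∫ z, h z * a x z ∂μ‖ ^ 2 : ℝ) : ℂ) =
      ∫ z : Ω × Ω, (k x : ℂ) * (h z.1 * a x z.1 * (starRingEnd ℂ) (h z.2 * a x z.2))
        ∂(μ.prod μ) := by
    intro x
    rw [integral_const_mul, integral_prod_mul (fun z => h z * a x z)
      (fun z => (starRingEnd ℂ) (h z * a x z)), integral_conj, Complex.mul_conj, ← Complex.sq_norm]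
    push_cast; rfl
  rw [← integral_complex_ofReal]
  simp_rw [h1]
  have hprod : Integrable (fun z : Ω × Ω => h z.1 * (starRingEnd ℂ) (h z.2)) (μ.prod μ) :=
    hh.mul_prod (g := fun z => (starRingEnd ℂ) (h z)) (Complex.conjCLE.integrable_comp_iff.2 hh)
  have hm : Measurable (fun p : X × Ω × Ω => a p.1 p.2.1 * (starRingEnd ℂ) (a p.1 p.2.2)) := by
    have e1 : Measurable (fun p : X × Ω × Ω => a p.1 p.2.1) :=
      ha.comp (measurable_fst.prodMk (measurable_fst.comp measurable_snd))
    have e2 : Measurable (fun p : X × Ω × Ω => a p.1 p.2.2) :=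
      ha.comp (measurable_fst.prodMk (measurable_snd.comp measurable_snd))
    exact e1.mul (Complex.continuous_conj.measurable.comp e2)
  rw [integral_integral_swap]
  · congr 1; ext z
    rw [← integral_const_mul]
    congr 1; ext x
    simp only [map_mul]; ring
  · have : Integrable (fun p : X × Ω × Ω => (k p.1 : ℂ) * (h p.2.1 * (starRingEnd ℂ) (h p.2.2)))
        (ν.prod (μ.prod μ)) := hk.ofReal.mul_prod hprod
    have := this.mul_bdd (c := 1) hm.aestronglyMeasurable (Filter.Eventually.of_forall fun p => by
      simp [ha1])
    refine this.congr (Filter.Eventually.of_forall fun p => ?_)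
    simp only [Function.uncurry, map_mul]; ring

lemma integral_gaussian_mul_unitPhase {ε : ℝ} (hε : 0 < ε) (t : ℝ) :
    ∫ x : ℝ, (Real.exp (-(Real.pi * ε ^ 2) * x ^ 2) : ℂ) * unitPhase (x * t) =
      ((ε⁻¹ * Real.exp (-(Real.pi / ε ^ 2) * t ^ 2) : ℝ) : ℂ) := by
  have hb : 0 < Real.pi * ε ^ 2 := by positivity
  have := fourierIntegral_gaussian (b := ((Real.pi * ε ^ 2 : ℝ) : ℂ)) (by rwa [Complex.ofReal_re])
    ((2 * Real.pi * t : ℝ) : ℂ)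
  convert this using 1
  · congr 1; ext x
    unfold unitPhase
    rw [mul_comm]
    push_cast
    congr 2; ring
  · have e1 : ((Real.pi : ℂ) / ((Real.pi * ε ^ 2 : ℝ) : ℂ)) ^ (1 / 2 : ℂ) = ((ε⁻¹ : ℝ) : ℂ) := by
      have : (Real.pi : ℂ) / ((Real.pi * ε ^ 2 : ℝ) : ℂ) = (((ε⁻¹) ^ 2 : ℝ) : ℂ) := by
        have := Real.pi_ne_zero
        rw [← Complex.ofReal_div]; congr 1; field_simp
      rw [this, show (1 / 2 : ℂ) = ((1 / 2 : ℝ) : ℂ) by push_cast; rfl,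
        ← Complex.ofReal_cpow (by positivity), ← Real.sqrt_eq_rpow, Real.sqrt_sq (by positivity)]
    rw [e1]
    push_cast
    congr 2
    have h1 := Complex.ofReal_ne_zero.2 Real.pi_ne_zero
    have h2 := Complex.ofReal_ne_zero.2 hε.ne'
    field_simp; norm_num

/-- The Gaussian weight `exp (-πε²|x|²)` on the plane. -/
def planeGaussian (ε : ℝ) (x : ℝ × ℝ) : ℝ :=
  Real.exp (-(Real.pi * ε ^ 2) * x.1 ^ 2) * Real.exp (-(Real.pi * ε ^ 2) * x.2 ^ 2)

/-- The Fourier transform `ε⁻² exp (-π|y|²/ε²)` of `planeGaussian ε`. -/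
def planeHeatKernel (ε : ℝ) (y : ℝ × ℝ) : ℝ :=
  (ε⁻¹ * Real.exp (-(Real.pi / ε ^ 2) * y.1 ^ 2)) * (ε⁻¹ * Real.exp (-(Real.pi / ε ^ 2) * y.2 ^ 2))

lemma integrable_planeGaussian {ε : ℝ} (hε : 0 < ε) : Integrable (planeGaussian ε) := by
  have h := integrable_exp_neg_mul_sq (b := Real.pi * ε ^ 2) (by positivity)
  exact h.mul_prod h

lemma planeGaussian_nonneg (ε : ℝ) (x : ℝ × ℝ) : 0 ≤ planeGaussian ε x := by
  unfold planeGaussian; positivity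

lemma planeHeatKernel_nonneg {ε : ℝ} (hε : 0 < ε) (x : ℝ × ℝ) : 0 ≤ planeHeatKernel ε x := by
  unfold planeHeatKernel; positivity

lemma integral_planeGaussian_mul_unitPhase {ε : ℝ} (hε : 0 < ε) (y : ℝ × ℝ) :
    ∫ x : ℝ × ℝ, (planeGaussian ε x : ℂ) * unitPhase (x.1 * y.1 + x.2 * y.2) =
      (planeHeatKernel ε y : ℂ) := by
  unfold planeHeatKernel
  rw [Complex.ofReal_mul, ← integral_gaussian_mul_unitPhase hε, ← integral_gaussian_mul_unitPhase hε,
    ← integral_prod_mul]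
  rw [Measure.volume_eq_prod]
  congr 1; ext x
  rw [unitPhase_add]; unfold planeGaussian; push_cast; ring

lemma lintegral_planeHeatKernel {ε : ℝ} (hε : 0 < ε) (y : ℝ × ℝ) :
    ∫⁻ x, ENNReal.ofReal (planeHeatKernel ε (y - x)) = 1 := by
  rw [lintegral_sub_left_eq_self (fun x => ENNReal.ofReal (planeHeatKernel ε x)) y]
  have hint : Integrable (fun t : ℝ => ε⁻¹ * Real.exp (-(Real.pi / ε ^ 2) * t ^ 2)) :=
    (integrable_exp_neg_mul_sq (by positivity)).const_mul _
  have h1 : ∫ t : ℝ, ε⁻¹ * Real.exp (-(Real.pi / ε ^ 2) * t ^ 2) = 1 := by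
    rw [integral_const_mul, integral_gaussian]
    have : Real.pi / (Real.pi / ε ^ 2) = ε ^ 2 := by
      have := Real.pi_ne_zero
      field_simp
    rw [this, Real.sqrt_sq hε.le, inv_mul_cancel₀ hε.ne']
  have hint2 : Integrable (planeHeatKernel ε) := hint.mul_prod hint
  rw [← ofReal_integral_eq_lintegral_ofReal hint2
    (Filter.Eventually.of_forall (planeHeatKernel_nonneg hε))]
  have : ∫ x, planeHeatKernel ε x = 1 := by
    unfold planeHeatKernel
    rw [Measure.volume_eq_prod]
    rw [integral_prod_mul (fun t : ℝ => ε⁻¹ * Real.exp (-(Real.pi / ε ^ 2) * t ^ 2))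
      (fun t : ℝ => ε⁻¹ * Real.exp (-(Real.pi / ε ^ 2) * t ^ 2)), h1, mul_one]
  simp [this]

/-- The superposition of plane waves with frequencies `Φ z` and amplitude `h`. -/
def oscillatorySuperposition {Ω : Type*} [MeasurableSpace Ω] (μ : Measure Ω) (Φ : Ω → ℝ × ℝ)
    (h : Ω → ℂ) (x : ℝ × ℝ) : ℂ :=
  ∫ z, h z * unitPhase (x.1 * (Φ z).1 + x.2 * (Φ z).2) ∂μ

lemma aestronglyMeasurable_oscillatorySuperposition {Ω : Type*} [MeasurableSpace Ω] {μ : Measure Ω}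
    [SFinite μ] {Φ : Ω → ℝ × ℝ} (hΦ : Measurable Φ) {h : Ω → ℂ} (hh : AEStronglyMeasurable h μ) :
    AEStronglyMeasurable (oscillatorySuperposition μ Φ h) volume := by
  unfold oscillatorySuperposition
  refine AEStronglyMeasurable.integral_prod_right' (μ := volume)
    (f := fun p : (ℝ × ℝ) × Ω => h p.2 * unitPhase (p.1.1 * (Φ p.2).1 + p.1.2 * (Φ p.2).2)) ?_
  refine hh.comp_snd.mul (Measurable.aestronglyMeasurable ?_)
  fun_prop

lemma enorm_oscillatorySuperposition_le {Ω : Type*} [MeasurableSpace Ω] (μ : Measure Ω)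
    (Φ : Ω → ℝ × ℝ) (h : Ω → ℂ) (x : ℝ × ℝ) :
    ‖oscillatorySuperposition μ Φ h x‖ₑ ≤ ∫⁻ z, ‖h z‖ₑ ∂μ := by
  refine (enorm_integral_le_lintegral_enorm _).trans_eq ?_
  congr 1; ext z
  rw [enorm_mul, ← ofReal_norm (unitPhase _), norm_unitPhase]; simp

/-- For use with c and d the Jacobians at two points z and z': the term quadratic in the amplitude
at z then carries the Jacobian at z', ready for a change of variables in z', and conversely. -/
lemma ENNReal.two_mul_mul_le_weighted {a b c d : ℝ≥0∞} (ha : a ≠ ⊤) (hb : b ≠ ⊤) (hc : c ≠ 0)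
    (hc' : c ≠ ⊤) (hd : d ≠ 0) (hd' : d ≠ ⊤) :
    2 * (a * b) ≤ a ^ 2 / c * d + b ^ 2 / d * c := by
  lift a to ℝ≥0 using ha
  lift b to ℝ≥0 using hb
  lift c to ℝ≥0 using hc'
  lift d to ℝ≥0 using hd'
  have hc0 : c ≠ 0 := by simpa using hc
  have hd0 : d ≠ 0 := by simpa using hd
  rw [← ENNReal.coe_pow, ← ENNReal.coe_pow, ← ENNReal.coe_div hc0, ← ENNReal.coe_div hd0]
  norm_cast
  rw [← NNReal.coe_le_coe]
  push_cast
  have hc1 : (0 : ℝ) < c := by positivity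
  have hd1 : (0 : ℝ) < d := by positivity
  have : (a : ℝ) ^ 2 / c * d + b ^ 2 / d * c - 2 * (a * b) = (a * d - b * c) ^ 2 / (c * d) := by
    field_simp; ring
  have h2 : (0 : ℝ) ≤ (a * d - b * c) ^ 2 / (c * d) := by positivity
  linarith

section
variable {T : Set (ℝ × ℝ)} {Φ : ℝ × ℝ → ℝ × ℝ} {Φ' : ℝ × ℝ → (ℝ × ℝ) →L[ℝ] (ℝ × ℝ)}

/-- The Gaussian makes the x-integral absolutely convergent, so the expanded square can be
integrated in x first, leaving a heat kernel at Φ z - Φ z'. A Schur test takes the place of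
Plancherel: the kernel has mass one in the image variable, and the weighted arithmetic–geometric
mean inequality distributes the Jacobians. The bound does not depend on ε. -/
lemma lintegral_planeGaussian_mul_sq_le (hT : MeasurableSet T)
    (hΦ : Measurable Φ) (hd : ∀ z ∈ T, HasFDerivWithinAt Φ (Φ' z) T z) (hinj : Set.InjOn Φ T)
    (hJ : Measurable fun z => (Φ' z).det) (hJ0 : ∀ z ∈ T, (Φ' z).det ≠ 0)
    {h : ℝ × ℝ → ℂ} (hm : Measurable h) (hh : Integrable h (volume.restrict T))
    {ε : ℝ} (hε : 0 < ε) :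
    ∫⁻ x, ENNReal.ofReal (planeGaussian ε x) *
        ‖oscillatorySuperposition (volume.restrict T) Φ h x‖ₑ ^ 2 ≤
      ∫⁻ z in T, ‖h z‖ₑ ^ 2 / ENNReal.ofReal |(Φ' z).det| := by
  set μ := volume.restrict T with hμ
  set S := oscillatorySuperposition μ Φ h with hS
  set J : ℝ × ℝ → ℝ≥0∞ := fun z => ENNReal.ofReal |(Φ' z).det| with hJdef
  set k : ℝ × ℝ → ℝ≥0∞ := fun y => ENNReal.ofReal (planeHeatKernel ε y) with hkdef
  have hJm : Measurable J := by
    have : Measurable fun z => |(Φ' z).det| := hJ.abs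
    exact this.ennreal_ofReal
  have hkm : Measurable k := by
    refine Measurable.ennreal_ofReal ?_
    unfold planeHeatKernel; fun_prop
  have hksymm : ∀ y y', k (y - y') = k (y' - y) := by
    intro y y'
    simp only [hkdef, planeHeatKernel, Prod.fst_sub, Prod.snd_sub]
    rw [show (y.1 - y'.1) ^ 2 = (y'.1 - y.1) ^ 2 by ring,
      show (y.2 - y'.2) ^ 2 = (y'.2 - y.2) ^ 2 by ring]
  have hSb : ∀ x, ‖S x‖ ≤ ∫ z, ‖h z‖ ∂μ := by
    intro x
    refine (norm_integral_le_integral_norm _).trans_eq ?_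
    simp [norm_unitPhase]
  have hSm : AEStronglyMeasurable S volume :=
    aestronglyMeasurable_oscillatorySuperposition hΦ hh.1
  have hkS : Integrable (fun x => planeGaussian ε x * ‖S x‖ ^ 2) := by
    refine (integrable_planeGaussian hε).mul_bdd (c := (∫ z, ‖h z‖ ∂μ) ^ 2) (hSm.norm.pow 2)
      (Filter.Eventually.of_forall fun x => ?_)
    rw [norm_pow, norm_norm]
    exact pow_le_pow_left₀ (norm_nonneg _) (hSb x) 2
  have e1 : ∫⁻ x, ENNReal.ofReal (planeGaussian ε x) * ‖S x‖ₑ ^ 2 =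
      ENNReal.ofReal (∫ x, planeGaussian ε x * ‖S x‖ ^ 2) := by
    rw [ofReal_integral_eq_lintegral_ofReal hkS (Filter.Eventually.of_forall fun x =>
      mul_nonneg (planeGaussian_nonneg ε x) (by positivity))]
    congr 1; ext x
    rw [ENNReal.ofReal_mul (planeGaussian_nonneg ε x), ENNReal.ofReal_pow (norm_nonneg _),
      ofReal_norm]
  have e2 : ((∫ x, planeGaussian ε x * ‖S x‖ ^ 2 : ℝ) : ℂ) =
      ∫ z : (ℝ × ℝ) × (ℝ × ℝ), h z.1 * (starRingEnd ℂ) (h z.2) *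
        (planeHeatKernel ε (Φ z.1 - Φ z.2) : ℂ) ∂(μ.prod μ) := by
    rw [hS]
    unfold oscillatorySuperposition
    rw [integral_mul_norm_sq_superposition hh (integrable_planeGaussian hε)
      (a := fun x z => unitPhase (x.1 * (Φ z).1 + x.2 * (Φ z).2)) (by
        unfold Function.uncurry; fun_prop) (fun x z => norm_unitPhase _)]
    congr 1; ext z
    rw [← integral_planeGaussian_mul_unitPhase hε]
    congr 2; ext x
    rw [conj_unitPhase, ← unitPhase_add]
    congr 2
    simp only [Prod.fst_sub, Prod.snd_sub]; ring
  have e3 : ENNReal.ofReal (∫ x, planeGaussian ε x * ‖S x‖ ^ 2) ≤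
      ∫⁻ z : (ℝ × ℝ) × (ℝ × ℝ), ‖h z.1‖ₑ * ‖h z.2‖ₑ * k (Φ z.1 - Φ z.2) ∂(μ.prod μ) := by
    have : ENNReal.ofReal (∫ x, planeGaussian ε x * ‖S x‖ ^ 2) ≤
        ‖((∫ x, planeGaussian ε x * ‖S x‖ ^ 2 : ℝ) : ℂ)‖ₑ := by
      rw [← ofReal_norm, Complex.norm_real]
      exact ENNReal.ofReal_le_ofReal (le_abs_self _)
    refine this.trans ?_
    rw [e2]
    refine (enorm_integral_le_lintegral_enorm _).trans_eq ?_
    congr 1; ext z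
    rw [enorm_mul, enorm_mul, ← ofReal_norm ((starRingEnd ℂ) (h z.2)), RCLike.norm_conj, ofReal_norm,
      ← ofReal_norm (planeHeatKernel ε _ : ℂ), Complex.norm_real,
      Real.norm_of_nonneg (planeHeatKernel_nonneg hε _)]
  set Q : ℝ≥0∞ := ∫⁻ z in T, ‖h z‖ₑ ^ 2 / J z with hQ
  have hhm : Measurable fun z => ‖h z‖ₑ := hm.enorm
  have hI : ∫⁻ z, ∫⁻ z', ‖h z‖ₑ ^ 2 / J z * J z' * k (Φ z - Φ z') ∂μ ∂μ ≤ Q := by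
    refine lintegral_mono fun z => ?_
    have : ∀ z', ‖h z‖ₑ ^ 2 / J z * J z' * k (Φ z - Φ z') =
        ‖h z‖ₑ ^ 2 / J z * (J z' * k (Φ z - Φ z')) := fun z' => mul_assoc _ _ _
    simp_rw [this]
    rw [lintegral_const_mul _ (by fun_prop)]
    conv_rhs => rw [← mul_one (‖h z‖ₑ ^ 2 / J z)]
    gcongr
    -- Injectivity is used here: z' is replaced by Φ z', and enlarging the image of T to the whole
    -- plane costs at most the unit mass of the kernel.
    rw [hμ, ← lintegral_image_eq_lintegral_abs_det_fderiv_mul volume hT hd hinj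
      (fun y => k (Φ z - y))]
    exact (setLIntegral_le_lintegral _ _).trans_eq (lintegral_planeHeatKernel hε _)
  have hmeas1 : Measurable fun z : (ℝ × ℝ) × (ℝ × ℝ) =>
      ‖h z.1‖ₑ ^ 2 / J z.1 * J z.2 * k (Φ z.1 - Φ z.2) := by fun_prop
  have hmeas2 : Measurable fun z : (ℝ × ℝ) × (ℝ × ℝ) =>
      ‖h z.2‖ₑ ^ 2 / J z.2 * J z.1 * k (Φ z.1 - Φ z.2) := by fun_prop
  have hI1 : ∫⁻ z : (ℝ × ℝ) × (ℝ × ℝ), ‖h z.1‖ₑ ^ 2 / J z.1 * J z.2 * k (Φ z.1 - Φ z.2)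
      ∂(μ.prod μ) ≤ Q := by
    rw [lintegral_prod _ hmeas1.aemeasurable]; exact hI
  have hI2 : ∫⁻ z : (ℝ × ℝ) × (ℝ × ℝ), ‖h z.2‖ₑ ^ 2 / J z.2 * J z.1 * k (Φ z.1 - Φ z.2)
      ∂(μ.prod μ) ≤ Q := by
    rw [lintegral_prod_symm _ hmeas2.aemeasurable]
    simp_rw [fun z z' => hksymm (Φ z) (Φ z')]
    exact hI
  have hae : ∀ᵐ z : (ℝ × ℝ) × (ℝ × ℝ) ∂(μ.prod μ), z.1 ∈ T ∧ z.2 ∈ T := by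
    rw [hμ, Measure.prod_restrict]
    filter_upwards [ae_restrict_mem (hT.prod hT)] with z hz using hz
  have h2 : 2 * ∫⁻ z : (ℝ × ℝ) × (ℝ × ℝ), ‖h z.1‖ₑ * ‖h z.2‖ₑ * k (Φ z.1 - Φ z.2) ∂(μ.prod μ) ≤
      2 * Q := by
    rw [← lintegral_const_mul' _ _ (by norm_num), two_mul Q]
    refine le_trans ?_ (add_le_add hI1 hI2)
    rw [← lintegral_add_left hmeas1]
    refine lintegral_mono_ae ?_
    filter_upwards [hae] with z hz
    rw [← mul_assoc, ← add_mul]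
    gcongr
    exact ENNReal.two_mul_mul_le_weighted enorm_ne_top enorm_ne_top
      (by simpa [hJdef] using hJ0 _ hz.1) ENNReal.ofReal_ne_top
      (by simpa [hJdef] using hJ0 _ hz.2) ENNReal.ofReal_ne_top
  rw [e1]
  refine e3.trans ?_
  rwa [ENNReal.mul_le_mul_iff_right (by norm_num) (by norm_num)] at h2

/-- The `L²` bound for a superposition of plane waves whose frequencies are parametrized by an
injective differentiable map. -/
lemma lintegral_oscillatorySuperposition_sq_le (hT : MeasurableSet T)
    (hΦ : Measurable Φ) (hd : ∀ z ∈ T, HasFDerivWithinAt Φ (Φ' z) T z) (hinj : Set.InjOn Φ T)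
    (hJ : Measurable fun z => (Φ' z).det) (hJ0 : ∀ z ∈ T, (Φ' z).det ≠ 0)
    {h : ℝ × ℝ → ℂ} (hm : Measurable h) (hh : Integrable h (volume.restrict T)) :
    ∫⁻ x, ‖oscillatorySuperposition (volume.restrict T) Φ h x‖ₑ ^ 2 ≤
      ∫⁻ z in T, ‖h z‖ₑ ^ 2 / ENNReal.ofReal |(Φ' z).det| := by
  set S := oscillatorySuperposition (volume.restrict T) Φ h with hS
  have hSm : AEStronglyMeasurable S volume :=
    aestronglyMeasurable_oscillatorySuperposition hΦ hh.1
  have hlim : ∀ x, Filter.Tendsto (fun n : ℕ =>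
      ENNReal.ofReal (planeGaussian (1 / ((n : ℝ) + 1)) x) * ‖S x‖ₑ ^ 2)
      Filter.atTop (nhds (‖S x‖ₑ ^ 2)) := by
    intro x
    have h0 : Filter.Tendsto (fun n : ℕ => planeGaussian (1 / ((n : ℝ) + 1)) x) Filter.atTop
        (nhds (planeGaussian 0 x)) := by
      have : Continuous fun ε => planeGaussian ε x := by unfold planeGaussian; fun_prop
      exact (this.tendsto 0).comp tendsto_one_div_add_atTop_nhds_zero_nat
    have h1 : planeGaussian 0 x = 1 := by simp [planeGaussian]
    rw [h1] at h0
    have := ENNReal.Tendsto.mul_const (b := ‖S x‖ₑ ^ 2) (ENNReal.tendsto_ofReal h0) (Or.inl (by simp))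
    simpa using this
  -- Fatou's lemma along ε = 1/(n+1): the weights tend to 1 pointwise and the bound is uniform in ε.
  calc ∫⁻ x, ‖S x‖ₑ ^ 2 = ∫⁻ x, Filter.liminf (fun n : ℕ =>
      ENNReal.ofReal (planeGaussian (1 / ((n : ℝ) + 1)) x) * ‖S x‖ₑ ^ 2) Filter.atTop := by
        congr 1; ext x; exact (hlim x).liminf_eq.symm
    _ ≤ Filter.liminf (fun n : ℕ => ∫⁻ x,
      ENNReal.ofReal (planeGaussian (1 / ((n : ℝ) + 1)) x) * ‖S x‖ₑ ^ 2) Filter.atTop := by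
        refine lintegral_liminf_le' fun n => ?_
        refine AEMeasurable.mul (Measurable.aemeasurable ?_) (hSm.enorm.pow_const 2)
        unfold planeGaussian; fun_prop
    _ ≤ _ := by
        refine Filter.liminf_le_of_le (by isBoundedDefault) fun b hb => ?_
        obtain ⟨n, hn⟩ := hb.exists
        exact hn.trans (lintegral_planeGaussian_mul_sq_le hT hΦ hd hinj hJ hJ0 hm hh (by positivity))

end

/-! ### The weighted Hausdorff–Young inequality by real interpolation -/

lemma setLIntegral_Ioc_rpow_sub_one {s c : ℝ} (hs : 0 < s) (hc : 0 ≤ c) :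
    ∫⁻ t in Set.Ioc 0 c, ENNReal.ofReal (t ^ (s - 1)) = ENNReal.ofReal (c ^ s / s) := by
  have hi : IntervalIntegrable (fun t : ℝ => t ^ (s - 1)) volume 0 c :=
    intervalIntegral.intervalIntegrable_rpow' (by linarith)
  rw [← ofReal_integral_eq_lintegral_ofReal ((intervalIntegrable_iff_integrableOn_Ioc_of_le hc).1 hi),
    ← intervalIntegral.integral_of_le hc, integral_rpow (Or.inl (by linarith))]
  · simp [Real.zero_rpow hs.ne']
  · filter_upwards [ae_restrict_mem measurableSet_Ioc] with t ht
    exact Real.rpow_nonneg ht.1.le _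

lemma oscillatorySuperposition_add {Ω : Type*} [MeasurableSpace Ω] {μ : Measure Ω}
    {Φ : Ω → ℝ × ℝ} (hΦ : Measurable Φ) {f g : Ω → ℂ} (hf : Integrable f μ) (hg : Integrable g μ)
    (x : ℝ × ℝ) : oscillatorySuperposition μ Φ (f + g) x =
      oscillatorySuperposition μ Φ f x + oscillatorySuperposition μ Φ g x := by
  have hm : AEStronglyMeasurable (fun z => unitPhase (x.1 * (Φ z).1 + x.2 * (Φ z).2)) μ := by
    refine Measurable.aestronglyMeasurable ?_
    fun_prop
  have hb : ∀ᵐ z ∂μ, ‖unitPhase (x.1 * (Φ z).1 + x.2 * (Φ z).2)‖ ≤ 1 :=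
    Filter.Eventually.of_forall fun z => (norm_unitPhase _).le
  unfold oscillatorySuperposition
  rw [← integral_add (hf.mul_bdd hm hb) (hg.mul_bdd hm hb)]
  simp [add_mul]

/-- The distributional estimate behind the weighted Hausdorff–Young inequality: the part of `h`
that is large relative to the level is controlled by `L¹ → L^∞`, the rest by `L² → L²`. -/
lemma measure_lt_norm_oscillatorySuperposition_le {Ω : Type*} [MeasurableSpace Ω] {μ : Measure Ω}
    [SFinite μ] {Φ : Ω → ℝ × ℝ} (hΦ : Measurable Φ) {w : Ω → ℝ≥0∞}
    (hL2 : ∀ h : Ω → ℂ, Measurable h → Integrable h μ →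
      ∫⁻ x, ‖oscillatorySuperposition μ Φ h x‖ₑ ^ 2 ≤ ∫⁻ z, ‖h z‖ₑ ^ 2 / w z ∂μ)
    {h : Ω → ℂ} (hm : Measurable h) (hh : Integrable h μ) {B : Ω → ℝ} (hB : Measurable B)
    {a : ℝ} (ha : 0 < a) (hA : ∫⁻ z, ENNReal.ofReal (B z) * ‖h z‖ₑ ∂μ ≤ ENNReal.ofReal a)
    {t : ℝ} (ht : 0 < t) :
    volume {x | t < ‖oscillatorySuperposition μ Φ h x‖} ≤
      ENNReal.ofReal (4 * t ^ (-2 : ℝ)) *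
        ∫⁻ z, {z | t * B z ≤ 2 * a}.indicator (fun z => ‖h z‖ₑ ^ 2 / w z) z ∂μ := by
  classical
  set D : Set Ω := {z | t * B z ≤ 2 * a} with hD
  have hDm : MeasurableSet D := measurableSet_le (by fun_prop) measurable_const
  have hsum : h = D.indicator h + Dᶜ.indicator h := (Set.indicator_self_add_compl D h).symm
  have hlo := hh.indicator hDm
  have hhi := hh.indicator hDm.compl
  -- Off `D` one has 2a < tB, so 2a|h| ≤ tB|h|, and ∫ B|h| ≤ a leaves mass at most t/2. Where the
  -- full superposition exceeds t, the part from `D` must therefore exceed t/2.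
  have hhigh : ∫⁻ z, ‖Dᶜ.indicator h z‖ₑ ∂μ ≤ ENNReal.ofReal (t / 2) := by
    have h1 : ENNReal.ofReal (2 * a) * ∫⁻ z, ‖Dᶜ.indicator h z‖ₑ ∂μ ≤
        ENNReal.ofReal t * ENNReal.ofReal a := by
      rw [← lintegral_const_mul' _ _ ENNReal.ofReal_ne_top]
      refine le_trans ?_ (mul_le_mul_right hA _)
      rw [← lintegral_const_mul' _ _ ENNReal.ofReal_ne_top]
      refine lintegral_mono fun z => ?_
      by_cases hz : z ∈ D
      · simp [hz]
      · rw [Set.indicator_of_mem (by exact hz), ← mul_assoc, ← ENNReal.ofReal_mul ht.le]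
        gcongr ENNReal.ofReal ?_ * _
        exact (not_le.1 hz).le
    have h2 : ENNReal.ofReal t * ENNReal.ofReal a =
        ENNReal.ofReal (2 * a) * ENNReal.ofReal (t / 2) := by
      rw [← ENNReal.ofReal_mul ht.le, ← ENNReal.ofReal_mul (by positivity)]
      congr 1; ring
    rw [h2] at h1
    rwa [ENNReal.mul_le_mul_iff_right (by simpa using ha) ENNReal.ofReal_ne_top] at h1
  have hsub : {x | t < ‖oscillatorySuperposition μ Φ h x‖} ⊆
      {x | ENNReal.ofReal ((t / 2) ^ 2) ≤ ‖oscillatorySuperposition μ Φ (D.indicator h) x‖ₑ ^ 2} := by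
    intro x hx
    simp only [Set.mem_ofPred_eq] at hx ⊢
    have e : oscillatorySuperposition μ Φ h x = oscillatorySuperposition μ Φ (D.indicator h) x +
        oscillatorySuperposition μ Φ (Dᶜ.indicator h) x := by
      rw [← oscillatorySuperposition_add hΦ hlo hhi, ← hsum]
    have h3 : ‖oscillatorySuperposition μ Φ (Dᶜ.indicator h) x‖ ≤ t / 2 := by
      have := (enorm_oscillatorySuperposition_le μ Φ (Dᶜ.indicator h) x).trans hhigh
      rwa [← ofReal_norm, ENNReal.ofReal_le_ofReal_iff (by positivity)] at this
    have h4 := norm_add_le (oscillatorySuperposition μ Φ (D.indicator h) x)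
      (oscillatorySuperposition μ Φ (Dᶜ.indicator h) x)
    rw [← e] at h4
    rw [← ofReal_norm, ← ENNReal.ofReal_pow (norm_nonneg _)]
    refine ENNReal.ofReal_le_ofReal (pow_le_pow_left₀ (by positivity) (by linarith) 2)
  refine (measure_mono hsub).trans ?_
  have hSm := aestronglyMeasurable_oscillatorySuperposition hΦ hlo.1
  -- Chebyshev for the square at level (t/2)², the source of the factor 4t⁻².
  refine (meas_ge_le_lintegral_div (hSm.enorm.pow_const 2) (by
    rw [Ne, ENNReal.ofReal_eq_zero, not_le]; positivity) ENNReal.ofReal_ne_top).trans ?_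
  rw [div_eq_mul_inv, mul_comm, ← ENNReal.ofReal_inv_of_pos (by positivity)]
  have h5 : ((t / 2) ^ 2)⁻¹ = 4 * t ^ (-2 : ℝ) := by
    rw [Real.rpow_neg ht.le, show (2 : ℝ) = ((2 : ℕ) : ℝ) by norm_num, Real.rpow_natCast]
    push_cast
    field_simp
    norm_num
  rw [h5]
  gcongr
  refine (hL2 _ (hm.indicator hDm) hlo).trans (lintegral_mono fun z => ?_)
  by_cases hz : z ∈ D <;> simp [hz]

/-- A weighted Hausdorff–Young inequality. -/
lemma lintegral_oscillatorySuperposition_rpow_le {Ω : Type*} [MeasurableSpace Ω] {μ : Measure Ω}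
    [SFinite μ] {Φ : Ω → ℝ × ℝ} (hΦ : Measurable Φ) {w : Ω → ℝ} (hw : Measurable w)
    (hw0 : ∀ᵐ z ∂μ, 0 < w z)
    (hL2 : ∀ h : Ω → ℂ, Measurable h → Integrable h μ →
      ∫⁻ x, ‖oscillatorySuperposition μ Φ h x‖ₑ ^ 2 ≤
        ∫⁻ z, ‖h z‖ₑ ^ 2 / ENNReal.ofReal (w z) ∂μ)
    {ρ r : ℝ} (hρ : 1 < ρ) (hr : 2 < r) (hρr : (ρ - 1) * (r - 1) = 1)
    {h : Ω → ℂ} (hm : Measurable h) (hh : Integrable h μ) :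
    ∫⁻ x, ‖oscillatorySuperposition μ Φ h x‖ₑ ^ r ≤
      ENNReal.ofReal (r * 4 * 2 ^ (r - 2) / (r - 2)) *
        (∫⁻ z, ENNReal.ofReal (‖h z‖ ^ ρ * w z ^ (1 - ρ)) ∂μ) ^ (r - 1) := by
  set S := oscillatorySuperposition μ Φ h with hS
  set A : ℝ≥0∞ := ∫⁻ z, ENNReal.ofReal (‖h z‖ ^ ρ * w z ^ (1 - ρ)) ∂μ with hA
  -- This truncation function meets two demands: B|h| is the integrand of `A`, and B^(r-1) = |h|/w
  -- because (ρ-1)(r-1) = 1.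
  set B : Ω → ℝ := fun z => ‖h z‖ ^ (ρ - 1) * w z ^ (1 - ρ) with hBdef
  have hC : 0 < r * 4 * 2 ^ (r - 2) / (r - 2) := by
    have : 0 < r - 2 := by linarith
    positivity
  have hBm : Measurable B := by fun_prop
  have hBh : ∀ z, ‖h z‖ ^ ρ * w z ^ (1 - ρ) = B z * ‖h z‖ := by
    intro z
    rcases eq_or_ne (‖h z‖) 0 with h0 | h0
    · simp [h0, Real.zero_rpow (by linarith : ρ ≠ 0)]
    · rw [hBdef]; simp only
      rw [Real.rpow_sub_one h0]; field_simp
  have hBA : ∫⁻ z, ENNReal.ofReal (B z) * ‖h z‖ₑ ∂μ = A := by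
    rw [hA]; congr 1; ext z
    rw [hBh, ENNReal.ofReal_mul' (norm_nonneg _), ofReal_norm]
  by_cases hAtop : A = ⊤
  · rw [hAtop, ENNReal.top_rpow_of_pos (by linarith), ENNReal.mul_top (by simpa using hC)]
    exact le_top
  by_cases hA0 : A = 0
  · have : h =ᵐ[μ] 0 := by
      have h0 := (lintegral_eq_zero_iff (by fun_prop)).1 (hA.symm.trans hA0)
      filter_upwards [h0, hw0] with z hz hwz
      simp only [Pi.zero_apply, ENNReal.ofReal_eq_zero] at hz ⊢
      by_contra hne
      have : 0 < ‖h z‖ := norm_pos_iff.2 hne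
      have : 0 < ‖h z‖ ^ ρ * w z ^ (1 - ρ) := by positivity
      linarith
    have hS0 : ∀ x, S x = 0 := by
      intro x
      rw [hS, oscillatorySuperposition]
      rw [integral_eq_zero_of_ae]
      filter_upwards [this] with z hz
      simp [hz]
    simp [hS0, show 0 < r by linarith]
  set a : ℝ := A.toReal with hadef
  have ha : 0 < a := ENNReal.toReal_pos hA0 hAtop
  have haA : ENNReal.ofReal a = A := ENNReal.ofReal_toReal hAtop
  have hSm : AEStronglyMeasurable S volume :=
    aestronglyMeasurable_oscillatorySuperposition hΦ hh.1
  have e1 : ∫⁻ x, ‖S x‖ₑ ^ r = ∫⁻ x, ENNReal.ofReal (‖S x‖ ^ r) := by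
    congr 1; ext x
    rw [← ofReal_norm, ENNReal.ofReal_rpow_of_nonneg (norm_nonneg _) (by linarith)]
  rw [e1, lintegral_rpow_eq_lintegral_meas_lt_mul volume
    (Filter.Eventually.of_forall fun x => norm_nonneg _) hSm.norm.aemeasurable (by linarith)]
  set g : Ω → ℝ≥0∞ := fun z => ‖h z‖ₑ ^ 2 / ENNReal.ofReal (w z) with hg
  have hgm : Measurable g := by fun_prop
  have hmeas : Measurable fun p : ℝ × Ω => {p : ℝ × Ω | p.1 * B p.2 ≤ 2 * a}.indicator
      (fun p => ENNReal.ofReal (4 * p.1 ^ (r - 2 - 1)) * g p.2) p := by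
    refine Measurable.indicator (by fun_prop) ?_
    exact measurableSet_le (by fun_prop) measurable_const
  have hstep : ∫⁻ t in Set.Ioi (0 : ℝ), volume {x | t < ‖S x‖} * ENNReal.ofReal (t ^ (r - 1)) ≤
      ∫⁻ t in Set.Ioi (0 : ℝ), ∫⁻ z, {p : ℝ × Ω | p.1 * B p.2 ≤ 2 * a}.indicator
        (fun p => ENNReal.ofReal (4 * p.1 ^ (r - 2 - 1)) * g p.2) (t, z) ∂μ := by
    refine setLIntegral_mono' measurableSet_Ioi fun t ht => ?_
    have ht0 : 0 < t := ht
    refine (mul_le_mul_left (measure_lt_norm_oscillatorySuperposition_le hΦ hL2 hm hh hBm ha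
      (by rw [hBA, haA]) ht0) _).trans_eq ?_
    rw [mul_right_comm, ← ENNReal.ofReal_mul (by positivity), mul_assoc, ← Real.rpow_add ht0,
      ← lintegral_const_mul' _ _ ENNReal.ofReal_ne_top]
    congr 1; ext z
    rw [show -2 + (r - 1) = r - 2 - 1 by ring]
    by_cases hz : t * B z ≤ 2 * a <;> simp [hz, hg]
  have hinner : ∀ᵐ z ∂μ, ∫⁻ t in Set.Ioi (0 : ℝ), {p : ℝ × Ω | p.1 * B p.2 ≤ 2 * a}.indicator
        (fun p => ENNReal.ofReal (4 * p.1 ^ (r - 2 - 1)) * g p.2) (t, z) ≤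
      ENNReal.ofReal (4 * (2 * a) ^ (r - 2) / (r - 2)) * (ENNReal.ofReal (B z) * ‖h z‖ₑ) := by
    filter_upwards [hw0] with z hwz
    rcases eq_or_ne (h z) 0 with hz | hz
    · have : g z = 0 := by simp [hg, hz]
      have h0 : ∀ t, {p : ℝ × Ω | p.1 * B p.2 ≤ 2 * a}.indicator
          (fun p => ENNReal.ofReal (4 * p.1 ^ (r - 2 - 1)) * g p.2) (t, z) = 0 := fun t => by
        simp only [Set.indicator, this, mul_zero, ite_self]
      simp only [h0, lintegral_zero, zero_le]
    have hn : 0 < ‖h z‖ := norm_pos_iff.2 hz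
    have hBz : 0 < B z := by simp only [hBdef]; positivity
    have e2 : ∀ t, {p : ℝ × Ω | p.1 * B p.2 ≤ 2 * a}.indicator
        (fun p => ENNReal.ofReal (4 * p.1 ^ (r - 2 - 1)) * g p.2) (t, z) =
        (4 * g z) * (Set.Iic (2 * a / B z)).indicator
          (fun t => ENNReal.ofReal (t ^ (r - 2 - 1))) t := by
      intro t
      by_cases hc : t * B z ≤ 2 * a
      · have hc' : t ≤ 2 * a / B z := (le_div_iff₀ hBz).2 hc
        simp only [Set.indicator, Set.mem_ofPred_eq, hc, Set.mem_Iic, hc', if_true]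
        rw [ENNReal.ofReal_mul (by norm_num), ENNReal.ofReal_ofNat]; ring
      · have hc' : ¬ t ≤ 2 * a / B z := fun hcc => hc ((le_div_iff₀ hBz).1 hcc)
        simp [hc, hc']
    simp_rw [e2]
    rw [lintegral_const_mul _ (Measurable.indicator (by fun_prop) measurableSet_Iic),
      setLIntegral_indicator measurableSet_Iic, Set.inter_comm, Set.Ioi_inter_Iic,
      setLIntegral_Ioc_rpow_sub_one (by linarith) (by positivity)]
    simp only [hg]
    rw [← ofReal_norm, ← ENNReal.ofReal_pow hn.le, ← ENNReal.ofReal_div_of_pos hwz,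
      ← ENNReal.ofReal_ofNat (n := 4), ← ENNReal.ofReal_mul (by norm_num),
      ← ENNReal.ofReal_mul (by positivity), ← ENNReal.ofReal_mul hBz.le,
      ← ENNReal.ofReal_mul (by have : 0 < r - 2 := by linarith
                               positivity)]
    refine ENNReal.ofReal_le_ofReal (le_of_eq ?_)
    rw [Real.div_rpow (by positivity) hBz.le]
    -- Integrating t^(r-3) up to 2a/B (convergent at 0 since r > 2) gave a multiple of
    -- (a/B)^(r-2)|h|²/w. By this identity that is a^(r-2)B|h|, whose integral is again controlled
    -- by `A`.
    have e3 : B z ^ (r - 2) * (B z * ‖h z‖) = ‖h z‖ ^ 2 / w z := by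
      have e4 : B z ^ (r - 2) * B z = B z ^ (r - 1) := by
        rw [← Real.rpow_add_one hBz.ne']; congr 1; ring
      have e5 : B z ^ (r - 1) = ‖h z‖ * (w z)⁻¹ := by
        simp only [hBdef]
        rw [Real.mul_rpow (by positivity) (by positivity), ← Real.rpow_mul hn.le,
          ← Real.rpow_mul hwz.le, hρr, show (1 - ρ) * (r - 1) = -1 by linarith, Real.rpow_one,
          Real.rpow_neg_one]
      rw [← mul_assoc, e4, e5]; ring
    have hBr : 0 < B z ^ (r - 2) := by positivity
    rw [← e3]
    field_simp
  calc _ ≤ ENNReal.ofReal r * ∫⁻ z, (∫⁻ t in Set.Ioi (0 : ℝ),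
      {p : ℝ × Ω | p.1 * B p.2 ≤ 2 * a}.indicator
        (fun p => ENNReal.ofReal (4 * p.1 ^ (r - 2 - 1)) * g p.2) (t, z)) ∂μ := by
        gcongr
        refine hstep.trans_eq ?_
        exact lintegral_lintegral_swap (f := fun t z => {p : ℝ × Ω | p.1 * B p.2 ≤ 2 * a}.indicator
          (fun p => ENNReal.ofReal (4 * p.1 ^ (r - 2 - 1)) * g p.2) (t, z)) hmeas.aemeasurable
    _ ≤ ENNReal.ofReal r * ∫⁻ z, ENNReal.ofReal (4 * (2 * a) ^ (r - 2) / (r - 2)) *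
        (ENNReal.ofReal (B z) * ‖h z‖ₑ) ∂μ := by
        gcongr 1
        exact lintegral_mono_ae hinner
    _ = _ := by
        rw [lintegral_const_mul' _ _ ENNReal.ofReal_ne_top, hBA, ← haA,
          ENNReal.ofReal_rpow_of_pos ha, ← ENNReal.ofReal_mul (by
            have : 0 < r - 2 := by linarith
            positivity), ← ENNReal.ofReal_mul (by linarith), ← ENNReal.ofReal_mul hC.le]
        congr 1
        rw [Real.mul_rpow (by norm_num) ha.le, show r - 1 = (r - 2) + 1 by ring,
          Real.rpow_add_one ha.ne']
        ring

/-! ### The Hardy–Littlewood–Sobolev inequality on the diagonal -/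

lemma lintegral_comp_abs_eq (f : ℝ → ℝ≥0∞) (hf : Measurable f) :
    ∫⁻ y, f |y| = 2 * ∫⁻ y in Set.Ioi (0 : ℝ), f y := by
  rw [← lintegral_add_compl (fun y => f |y|) (measurableSet_Ioi (a := (0 : ℝ))), Set.compl_Ioi,
    two_mul]
  have h1 : ∫⁻ y in Set.Ioi (0 : ℝ), f |y| = ∫⁻ y in Set.Ioi (0 : ℝ), f y :=
    setLIntegral_congr_fun measurableSet_Ioi fun y hy => by simp only [abs_of_pos (Set.mem_Ioi.1 hy)]
  have h2 : ∫⁻ y in Set.Iic (0 : ℝ), f |y| = ∫⁻ y in Set.Ioi (0 : ℝ), f y := by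
    rw [← h1, ← setLIntegral_congr (Ioi_ae_eq_Ici (a := (0 : ℝ)) (μ := volume)).symm]
    have := (Measure.measurePreserving_neg (volume : Measure ℝ)).setLIntegral_comp_preimage
      (measurableSet_Iic (a := (0 : ℝ))) (f := fun y => f |y|) (by fun_prop)
    rw [← this]
    simp
  rw [h1, h2]

/-- The local part of the fractional integral of a function that is small off its large values. -/
lemma lintegral_sublevel_mul_rpow_abs_sub_le {γ : ℝ} (hγ0 : 0 < γ) (hγ1 : γ < 1) {u : ℝ → ℝ}
    (hu : Measurable u) (ξ : ℝ) {t N : ℝ} (ht : 0 < t) (hN : 0 < N)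
    (hNu : ∫⁻ η, ENNReal.ofReal (u η) ^ (2 / (2 - γ)) ≤ ENNReal.ofReal N) :
    ∫⁻ η, {η | u η ≤ t}.indicator
        (fun η => ENNReal.ofReal (u η) * ENNReal.ofReal (|ξ - η| ^ (-γ))) η ≤
      ENNReal.ofReal ((2 / (1 - γ) + 2 ^ (γ / 2)) * (N ^ (1 - γ) * t ^ (2 / (2 - γ) - 1))) := by
  set s := 2 / (2 - γ) with hs
  have hs0 : 0 < s := div_pos two_pos (by linarith)
  have hsinv : 1 / s = 1 - γ / 2 := by rw [hs]; field_simp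
  -- The radius that balances the two parts. Near ξ the bound u ≤ t gives about tR^(1-γ); far from ξ
  -- Hölder gives about N^(1-γ/2)R^(-γ/2). With s(2-γ) = 2 both equal N^(1-γ)t^(s-1).
  set R : ℝ := N * t ^ (-s) with hR
  have hR0 : 0 < R := by positivity
  set near : ℝ → ℝ≥0∞ := fun y => (Set.Iic R).indicator (fun y => ENNReal.ofReal (y ^ (-γ))) y
  set far : ℝ → ℝ≥0∞ := fun y => (Set.Ioi R).indicator (fun y => ENNReal.ofReal (y ^ (-γ))) y
    with hfar
  have hnm : Measurable near := Measurable.indicator (by fun_prop) measurableSet_Iic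
  have hfm : Measurable far := Measurable.indicator (by fun_prop) measurableSet_Ioi
  have hnear : ∫⁻ η, near |ξ - η| = ENNReal.ofReal (2 * (R ^ (1 - γ) / (1 - γ))) := by
    rw [lintegral_sub_left_eq_self (fun y => near |y|) ξ, lintegral_comp_abs_eq _ hnm,
      setLIntegral_indicator measurableSet_Iic, Set.inter_comm, Set.Ioi_inter_Iic,
      ENNReal.ofReal_mul (by norm_num), ENNReal.ofReal_ofNat,
      ← setLIntegral_Ioc_rpow_sub_one (by linarith) hR0.le]
    simp
  have hfar2 : ∫⁻ η, far |ξ - η| ^ (2 / γ) = ENNReal.ofReal (2 / R) := by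
    rw [lintegral_sub_left_eq_self (fun y => far |y| ^ (2 / γ)) ξ,
      lintegral_comp_abs_eq (fun y => far y ^ (2 / γ)) (by fun_prop)]
    have h1 : ∀ y, far y ^ (2 / γ) = (Set.Ioi R).indicator
        (fun y => ENNReal.ofReal (y ^ (-2 : ℝ))) y := by
      intro y
      by_cases hy : y ∈ Set.Ioi R
      · have hy0 : 0 < y := hR0.trans hy
        simp only [hfar, Set.indicator_of_mem hy]
        rw [ENNReal.ofReal_rpow_of_pos (by positivity), ← Real.rpow_mul hy0.le]
        congr 2; field_simp
      · simp only [hfar, Set.indicator_of_notMem hy]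
        exact ENNReal.zero_rpow_of_pos (by positivity)
    simp_rw [h1]
    rw [setLIntegral_indicator measurableSet_Ioi,
      Set.inter_eq_left.2 (Set.Ioi_subset_Ioi hR0.le),
      ← ofReal_integral_eq_lintegral_ofReal (integrableOn_Ioi_rpow_of_lt (by norm_num) hR0)]
    · rw [integral_Ioi_rpow_of_lt (by norm_num) hR0, ← ENNReal.ofReal_ofNat (n := 2),
        ← ENNReal.ofReal_mul (by norm_num)]
      congr 1
      rw [show (-2 : ℝ) + 1 = -1 by norm_num, Real.rpow_neg_one]
      ring
    · filter_upwards [ae_restrict_mem measurableSet_Ioi] with y hy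
      exact Real.rpow_nonneg (hR0.trans hy).le _
  -- The exponent dual to s turns the kernel |y|^(-γ) into |y|⁻², which is integrable at infinity.
  have hconj : s.HolderConjugate (2 / γ) := by
    rw [Real.holderConjugate_iff]
    refine ⟨by rw [hs, lt_div_iff₀ (by linarith)]; linarith, ?_⟩
    rw [← one_div, hsinv, inv_div]; ring
  have hhold : ∫⁻ η, ENNReal.ofReal (u η) * far |ξ - η| ≤
      ENNReal.ofReal (N ^ (1 - γ / 2) * (2 / R) ^ (γ / 2)) := by
    have := ENNReal.lintegral_mul_le_Lp_mul_Lq volume hconj (f := fun η => ENNReal.ofReal (u η))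
      (g := fun η => far |ξ - η|) (by fun_prop) (by fun_prop)
    refine this.trans ?_
    rw [hfar2, hsinv, one_div_div, ENNReal.ofReal_mul (by positivity),
      ← ENNReal.ofReal_rpow_of_pos hN, ← ENNReal.ofReal_rpow_of_pos (by positivity)]
    gcongr
    linarith
  have hsplit : ∀ η, {η | u η ≤ t}.indicator
      (fun η => ENNReal.ofReal (u η) * ENNReal.ofReal (|ξ - η| ^ (-γ))) η ≤
      ENNReal.ofReal t * near |ξ - η| + ENNReal.ofReal (u η) * far |ξ - η| := by
    intro η
    by_cases hη : u η ≤ t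
    · rw [Set.indicator_of_mem (by exact hη)]
      by_cases hn : |ξ - η| ≤ R
      · refine le_add_right ?_
        simp only [near, Set.indicator_of_mem (Set.mem_Iic.2 hn)]
        gcongr
      · refine le_add_left ?_
        simp only [far, Set.indicator_of_mem (Set.mem_Ioi.2 (not_le.1 hn))]
        exact le_rfl
    · rw [Set.indicator_of_notMem (by exact hη)]; exact zero_le
  refine (lintegral_mono hsplit).trans ?_
  rw [lintegral_add_left (by fun_prop), lintegral_const_mul' _ _ ENNReal.ofReal_ne_top, hnear]
  refine (add_le_add_right hhold _).trans ?_
  rw [← ENNReal.ofReal_mul ht.le, ← ENNReal.ofReal_add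
    (by have : 0 < 1 - γ := by linarith
        positivity) (by positivity)]
  refine ENNReal.ofReal_le_ofReal (le_of_eq ?_)
  have hsγ : s * (2 - γ) = 2 := by rw [hs]; field_simp [show (2 - γ) ≠ 0 by linarith]
  have h1 : R ^ (1 - γ) = N ^ (1 - γ) * t ^ (s - 2) := by
    rw [hR, Real.mul_rpow hN.le (by positivity), ← Real.rpow_mul ht.le]
    congr 2; linarith
  have h2 : t * t ^ (s - 2) = t ^ (s - 1) := by
    rw [mul_comm, ← Real.rpow_add_one ht.ne']; congr 1; ring
  have h3 : (2 / R) ^ (γ / 2) = 2 ^ (γ / 2) * (N ^ (-(γ / 2)) * t ^ (s - 1)) := by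
    rw [Real.div_rpow (by norm_num) hR0.le, hR, Real.mul_rpow hN.le (by positivity),
      ← Real.rpow_mul ht.le, div_eq_mul_inv, mul_inv, ← Real.rpow_neg hN.le, ← Real.rpow_neg ht.le]
    congr 3; linarith
  have h4 : N ^ (1 - γ / 2) * N ^ (-(γ / 2)) = N ^ (1 - γ) := by
    rw [← Real.rpow_add hN]; congr 1; ring
  rw [h1, h3, add_mul, ← h4, ← h2]
  ring

/-- The Hardy–Littlewood–Sobolev inequality on the line, on the diagonal. -/
lemma lintegral_lintegral_mul_rpow_abs_sub_le {γ : ℝ} (hγ0 : 0 < γ) (hγ1 : γ < 1) {u : ℝ → ℝ}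
    (hu : Measurable u) :
    ∫⁻ ξ, ∫⁻ η, ENNReal.ofReal (u ξ) * (ENNReal.ofReal (u η) * ENNReal.ofReal (|ξ - η| ^ (-γ))) ≤
      ENNReal.ofReal (2 * (2 / (1 - γ) + 2 ^ (γ / 2))) *
        (∫⁻ η, ENNReal.ofReal (u η) ^ (2 / (2 - γ))) ^ (2 - γ) := by
  set s := 2 / (2 - γ) with hs
  have hs0 : 0 < s := div_pos two_pos (by linarith)
  have hsγ : s * (2 - γ) = 2 := by rw [hs]; field_simp [show (2 - γ) ≠ 0 by linarith]
  set A : ℝ≥0∞ := ∫⁻ η, ENNReal.ofReal (u η) ^ s with hA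
  have hγ1' : 0 < 1 - γ := by linarith
  set c : ℝ := 2 / (1 - γ) + 2 ^ (γ / 2) with hc
  have hc0 : 0 < c := by positivity
  by_cases hAtop : A = ⊤
  · rw [hAtop, ENNReal.top_rpow_of_pos (by linarith), ENNReal.mul_top (by
      rw [Ne, ENNReal.ofReal_eq_zero, not_le]; positivity)]
    exact le_top
  by_cases hA0 : A = 0
  · have h0 := (lintegral_eq_zero_iff (by fun_prop)).1 (hA.symm.trans hA0)
    have h1 : ∀ᵐ ξ : ℝ, ENNReal.ofReal (u ξ) = 0 := by
      filter_upwards [h0] with ξ hξ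
      exact (ENNReal.rpow_eq_zero_iff_of_pos hs0).1 hξ
    refine le_of_eq_of_le ?_ zero_le
    rw [lintegral_eq_zero_iff' (by
      refine Measurable.aemeasurable (Measurable.lintegral_prod_right' (f := fun p : ℝ × ℝ =>
        ENNReal.ofReal (u p.1) * (ENNReal.ofReal (u p.2) * ENNReal.ofReal (|p.1 - p.2| ^ (-γ)))) ?_)
      fun_prop)]
    filter_upwards [h1] with ξ hξ
    simp [hξ]
  set N := A.toReal with hN
  have hN0 : 0 < N := ENNReal.toReal_pos hA0 hAtop
  have hNA : ENNReal.ofReal N = A := ENNReal.ofReal_toReal hAtop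
  set F : ℝ → ℝ → ℝ≥0∞ := fun ξ η =>
    ENNReal.ofReal (u ξ) * (ENNReal.ofReal (u η) * ENNReal.ofReal (|ξ - η| ^ (-γ))) with hF
  have hFsymm : ∀ ξ η, F ξ η = F η ξ := by
    intro ξ η; simp only [hF]; rw [abs_sub_comm]; ring
  -- By symmetry it suffices to treat pairs with u(η) ≤ u(ξ). The sublevel estimate at level t =
  -- u(ξ) then bounds the inner integral by a multiple of u(ξ)·u(ξ)^(s-1) = u(ξ)^s, so no
  -- interpolation is needed.
  set G : ℝ → ℝ → ℝ≥0∞ := fun ξ η => {p : ℝ × ℝ | u p.2 ≤ u p.1}.indicator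
    (fun p => F p.1 p.2) (ξ, η) with hG
  have hGm : Measurable (Function.uncurry G) := by
    refine Measurable.indicator (f := fun p : ℝ × ℝ => F p.1 p.2) (by simp only [hF]; fun_prop) ?_
    exact measurableSet_le (by fun_prop) (by fun_prop)
  have hFG : ∀ ξ η, F ξ η ≤ G ξ η + G η ξ := by
    intro ξ η
    rcases le_total (u η) (u ξ) with h | h
    · refine le_add_right ?_
      simp only [hG]; rw [Set.indicator_of_mem (by exact h)]
    · refine le_add_left ?_
      simp only [hG]; rw [Set.indicator_of_mem (by exact h), hFsymm]
  have hGb : ∫⁻ ξ, ∫⁻ η, G ξ η ≤ ENNReal.ofReal c * A ^ (2 - γ) := by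
    have h1 : ∀ ξ, ∫⁻ η, G ξ η ≤ ENNReal.ofReal (c * N ^ (1 - γ)) * ENNReal.ofReal (u ξ) ^ s := by
      intro ξ
      rcases le_or_gt (u ξ) 0 with h | h
      · have : ∀ η, G ξ η = 0 := by
          intro η
          have hF0 : F ξ η = 0 := by simp [hF, ENNReal.ofReal_of_nonpos h]
          simp only [hG, Set.indicator, hF0, ite_self]
        simp [this]
      · have h2 := lintegral_sublevel_mul_rpow_abs_sub_le hγ0 hγ1 hu ξ h hN0 (by rw [hNA])
        have h3 : ∀ η, G ξ η = ENNReal.ofReal (u ξ) * {η | u η ≤ u ξ}.indicator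
            (fun η => ENNReal.ofReal (u η) * ENNReal.ofReal (|ξ - η| ^ (-γ))) η := by
          intro η
          by_cases hη : u η ≤ u ξ <;> simp [hG, hF, hη]
        simp_rw [h3]
        rw [lintegral_const_mul' _ _ ENNReal.ofReal_ne_top]
        refine (mul_le_mul_right h2 _).trans_eq ?_
        rw [← ENNReal.ofReal_mul h.le, ENNReal.ofReal_rpow_of_pos h,
          ← ENNReal.ofReal_mul (by positivity)]
        congr 1
        rw [← hs, ← hc, Real.rpow_sub_one h.ne']
        field_simp
    refine (lintegral_mono h1).trans_eq ?_
    rw [lintegral_const_mul' _ _ ENNReal.ofReal_ne_top, ← hA, ← hNA, ENNReal.ofReal_rpow_of_pos hN0,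
      ← ENNReal.ofReal_mul (by positivity), ← ENNReal.ofReal_mul hc0.le]
    congr 1
    rw [show 2 - γ = (1 - γ) + 1 by ring, Real.rpow_add_one hN0.ne']; ring
  calc ∫⁻ ξ, ∫⁻ η, F ξ η ≤ ∫⁻ ξ, ∫⁻ η, (G ξ η + G η ξ) :=
        lintegral_mono fun ξ => lintegral_mono fun η => hFG ξ η
    _ = (∫⁻ ξ, ∫⁻ η, G ξ η) + ∫⁻ ξ, ∫⁻ η, G η ξ := by
        rw [← lintegral_add_left hGm.lintegral_prod_right]
        congr 1; ext ξ
        exact lintegral_add_left (hGm.comp (measurable_const.prodMk measurable_id)) _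
    _ = 2 * ∫⁻ ξ, ∫⁻ η, G ξ η := by
        rw [lintegral_lintegral_swap (f := fun ξ η => G η ξ)
          (hGm.comp measurable_swap).aemeasurable, two_mul]
    _ ≤ 2 * (ENNReal.ofReal c * A ^ (2 - γ)) := by gcongr
    _ = _ := by
        rw [ENNReal.ofReal_mul (by norm_num), ENNReal.ofReal_ofNat, mul_assoc]

/-! ### The sum map of the curve and the bilinear estimate -/

/-- The open triangle `{(ξ, η) : -1 < ξ < η < 1}`. -/
def openTriangle : Set (ℝ × ℝ) := {z | -1 < z.1 ∧ z.1 < z.2 ∧ z.2 < 1}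

/-- The sum map `(ξ, η) ↦ (ξ, ψ(ξ)) + (η, ψ(η))` of the curve. -/
def curveSum (ψ : ℝ → ℝ) (z : ℝ × ℝ) : ℝ × ℝ := (z.1 + z.2, ψ z.1 + ψ z.2)

/-- The derivative of `curveSum ψ` when `ψ' = φ`. -/
def curveSumDeriv (φ : ℝ → ℝ) (z : ℝ × ℝ) : (ℝ × ℝ) →L[ℝ] (ℝ × ℝ) :=
  (ContinuousLinearMap.fst ℝ ℝ ℝ + ContinuousLinearMap.snd ℝ ℝ ℝ).prod
    (φ z.1 • ContinuousLinearMap.fst ℝ ℝ ℝ + φ z.2 • ContinuousLinearMap.snd ℝ ℝ ℝ)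

lemma measurableSet_openTriangle : MeasurableSet openTriangle := by
  refine (IsOpen.inter ?_ (IsOpen.inter ?_ ?_)).measurableSet
  · exact isOpen_lt continuous_const continuous_fst
  · exact isOpen_lt continuous_fst continuous_snd
  · exact isOpen_lt continuous_snd continuous_const

lemma det_curveSumDeriv (φ : ℝ → ℝ) (z : ℝ × ℝ) : (curveSumDeriv φ z).det = φ z.2 - φ z.1 := by
  rw [ContinuousLinearMap.det, ← LinearMap.det_toMatrix (Module.Basis.finTwoProd ℝ),
    Matrix.det_fin_two]
  simp [LinearMap.toMatrix_apply, curveSumDeriv]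

section
variable {v : ℝ} {Ψ φ : ℝ → ℝ}

lemma hasFDerivAt_curveSum (hΨ : ∀ x, HasDerivAt Ψ (φ x) x) (z : ℝ × ℝ) :
    HasFDerivAt (curveSum Ψ) (curveSumDeriv φ z) z := by
  have h1 : HasFDerivAt (fun z : ℝ × ℝ => Ψ z.1) (φ z.1 • ContinuousLinearMap.fst ℝ ℝ ℝ) z :=
    (hΨ z.1).comp_hasFDerivAt z hasFDerivAt_fst
  have h2 : HasFDerivAt (fun z : ℝ × ℝ => Ψ z.2) (φ z.2 • ContinuousLinearMap.snd ℝ ℝ ℝ) z :=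
    (hΨ z.2).comp_hasFDerivAt z hasFDerivAt_snd
  exact (hasFDerivAt_fst.add hasFDerivAt_snd).prodMk (h1.add h2)

/-- The first coordinate fixes the midpoint m. If two half-lengths s < t gave the same second
coordinate, Rolle's theorem for x ↦ Ψ(m-x) + Ψ(m+x) would give φ(m+c) = φ(m-c) with c > 0, against
the lower bound on differences of φ. -/
lemma injOn_curveSum (hv : 0 < v) (hΨ : ∀ x, HasDerivAt Ψ (φ x) x)
    (hlow : ∀ ξ ∈ Set.Icc (-1 : ℝ) 1, ∀ η ∈ Set.Icc (-1 : ℝ) 1, v * |ξ - η| ≤ |φ ξ - φ η|) :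
    Set.InjOn (curveSum Ψ) openTriangle := by
  have key : ∀ m s t : ℝ, 0 < s → s < t → -1 < m - t → m + t < 1 →
      Ψ (m - s) + Ψ (m + s) ≠ Ψ (m - t) + Ψ (m + t) := by
    intro m s t hs hst h1 h2 he
    have hd : ∀ x, HasDerivAt (fun x => Ψ (m - x) + Ψ (m + x)) (-φ (m - x) + φ (m + x)) x := by
      intro x
      exact ((hΨ (m - x)).comp_const_sub m x).add ((hΨ (m + x)).comp_const_add m x)
    obtain ⟨c, hc, hc0⟩ := exists_hasDerivAt_eq_zero hst
      (fun x _ => (hd x).continuousAt.continuousWithinAt) he (fun x _ => hd x)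
    have := hlow (m + c) ⟨by linarith [hc.1, hc.2], by linarith [hc.1, hc.2]⟩ (m - c)
      ⟨by linarith [hc.1, hc.2], by linarith [hc.1, hc.2]⟩
    rw [show φ (m + c) - φ (m - c) = 0 by linarith, abs_zero,
      show m + c - (m - c) = 2 * c by ring, abs_of_pos (by linarith [hc.1])] at this
    have : 0 < v * (2 * c) := mul_pos hv (by linarith [hc.1])
    linarith
  rintro ⟨a, b⟩ ⟨ha, hab, hb⟩ ⟨c, d⟩ ⟨hc, hcd, hd⟩ he
  simp only [curveSum, Prod.mk.injEq] at he ha hab hb hc hcd hd ⊢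
  obtain ⟨h1, h2⟩ := he
  have e1 : (a + b) / 2 - (b - a) / 2 = a := by ring
  have e2 : (a + b) / 2 + (b - a) / 2 = b := by ring
  have e3 : (a + b) / 2 - (d - c) / 2 = c := by rw [h1]; ring
  have e4 : (a + b) / 2 + (d - c) / 2 = d := by rw [h1]; ring
  rcases lt_trichotomy ((b - a) / 2) ((d - c) / 2) with h | h | h
  · refine absurd ?_ (key ((a + b) / 2) _ _ (by linarith) h (by linarith) (by linarith))
    rw [e1, e2, e3, e4, h2]
  · constructor <;> linarith
  · refine absurd ?_ (key ((a + b) / 2) _ _ (by linarith) h (by linarith) (by linarith))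
    rw [e1, e2, e3, e4, h2]

lemma measure_diagonal_eq_zero : volume {z : ℝ × ℝ | z.1 = z.2} = 0 := by
  have hm : MeasurableSet {z : ℝ × ℝ | z.1 = z.2} :=
    measurableSet_eq_fun measurable_fst measurable_snd
  rw [Measure.volume_eq_prod, Measure.measure_prod_null hm]
  refine Filter.Eventually.of_forall fun x => ?_
  have : Prod.mk x ⁻¹' {z : ℝ × ℝ | z.1 = z.2} = {x} := by
    ext y; simp [eq_comm]
  simp [this]

/-- The square of the extension as a superposition over the open triangle. -/
lemma intervalExtension_sq (hΨ : Measurable Ψ) {g : ℝ → ℂ} (hg : Integrable g intervalMeasure)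
    (x : ℝ × ℝ) :
    intervalExtension Ψ g x ^ 2 = 2 * oscillatorySuperposition (volume.restrict openTriangle)
      (curveSum Ψ) (fun z => g z.1 * g z.2) x := by
  have hIoo : intervalMeasure = volume.restrict (Set.Ioo (-1 : ℝ) 1) :=
    Measure.restrict_congr_set Ioo_ae_eq_Icc.symm
  set f : ℝ → ℂ := fun ξ => g ξ * unitPhase (x.1 * ξ + x.2 * Ψ ξ) with hf
  have hfi : Integrable f intervalMeasure := hg.mul_bdd (c := 1)
    (Measurable.aestronglyMeasurable (by fun_prop))
    (Filter.Eventually.of_forall fun z => (norm_unitPhase _).le)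
  set F : ℝ × ℝ → ℂ := fun z => f z.1 * f z.2 with hF
  set Q : Set (ℝ × ℝ) := Set.Ioo (-1) 1 ×ˢ Set.Ioo (-1) 1 with hQ
  have hprod : intervalMeasure.prod intervalMeasure = volume.restrict Q := by
    rw [hIoo, Measure.prod_restrict, ← Measure.volume_eq_prod]
  have h1 : intervalExtension Ψ g x ^ 2 = ∫ z in Q, F z := by
    rw [← hprod, hF, integral_prod_mul, sq]; rfl
  have hFi : IntegrableOn F Q volume := by
    have := hfi.mul_prod hfi
    rwa [hprod] at this
  -- Off the null diagonal the square is the triangle and its reflection. The integrand is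
  -- symmetric, whence the factor 2.
  have hQae : Q =ᵐ[volume] (openTriangle ∪ Prod.swap ⁻¹' openTriangle : Set (ℝ × ℝ)) := by
    have hd : ∀ᵐ z : ℝ × ℝ, z.1 ≠ z.2 := by
      rw [ae_iff]; simpa using measure_diagonal_eq_zero
    filter_upwards [hd] with z hz
    apply propext
    change z ∈ Q ↔ z ∈ openTriangle ∨ z ∈ Prod.swap ⁻¹' openTriangle
    simp only [hQ, openTriangle, Set.mem_prod, Set.mem_Ioo, Set.mem_ofPred_eq, Set.mem_preimage,
      Prod.fst_swap, Prod.snd_swap]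
    constructor
    · rintro ⟨⟨a1, a2⟩, a3, a4⟩
      rcases lt_or_gt_of_ne hz with h | h
      · exact Or.inl ⟨a1, h, a4⟩
      · exact Or.inr ⟨a3, h, a2⟩
    · rintro (⟨a1, a2, a3⟩ | ⟨a1, a2, a3⟩)
      · exact ⟨⟨a1, by linarith⟩, by linarith, a3⟩
      · exact ⟨⟨by linarith, a3⟩, a1, by linarith⟩
  have hswapm : MeasurableSet (Prod.swap ⁻¹' openTriangle) :=
    measurable_swap measurableSet_openTriangle
  have hdisj : Disjoint openTriangle (Prod.swap ⁻¹' openTriangle) := by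
    rw [Set.disjoint_left]
    rintro z ⟨_, h1, _⟩ ⟨_, h2, _⟩
    exact lt_asymm h1 h2
  have hFi' : IntegrableOn F (openTriangle ∪ Prod.swap ⁻¹' openTriangle) volume :=
    hFi.congr_set_ae hQae.symm
  rw [h1, setIntegral_congr_set hQae, setIntegral_union hdisj hswapm
    hFi'.left_of_union hFi'.right_of_union]
  have hsw : ∫ z in Prod.swap ⁻¹' openTriangle, F z = ∫ z in openTriangle, F z := by
    have hmp : MeasurePreserving (Prod.swap : ℝ × ℝ → ℝ × ℝ) volume volume := by
      rw [Measure.volume_eq_prod]; exact Measure.measurePreserving_swap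
    rw [← hmp.setIntegral_preimage_emb MeasurableEquiv.prodComm.measurableEmbedding F openTriangle]
    congr 1; ext z
    simp only [hF, Prod.fst_swap, Prod.snd_swap]; ring
  rw [hsw, ← two_mul]
  congr 1
  unfold oscillatorySuperposition
  congr 1; ext z
  simp only [hF, hf, curveSum]
  rw [show x.1 * (z.1 + z.2) + x.2 * (Ψ z.1 + Ψ z.2) =
    (x.1 * z.1 + x.2 * Ψ z.1) + (x.1 * z.2 + x.2 * Ψ z.2) by ring,
    unitPhase_add (x.1 * z.1 + x.2 * Ψ z.1)]
  ring

/-- The weighted energy of `g ⊗ g` over the triangle is controlled by fractional integration. -/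
lemma lintegral_triangle_energy_le (hv : 0 < v)
    (hlow : ∀ ξ ∈ Set.Icc (-1 : ℝ) 1, ∀ η ∈ Set.Icc (-1 : ℝ) 1, v * |ξ - η| ≤ |φ ξ - φ η|)
    {ρ : ℝ} (hρ1 : 1 < ρ) (hρ2 : ρ < 2) {g : ℝ → ℂ} (hgm : Measurable g) :
    ∫⁻ z in openTriangle,
        ENNReal.ofReal (‖g z.1 * g z.2‖ ^ ρ * |φ z.2 - φ z.1| ^ (1 - ρ)) ≤
      ENNReal.ofReal (v ^ (1 - ρ) * (2 * (2 / (2 - ρ) + 2 ^ ((ρ - 1) / 2)))) *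
        (∫⁻ ξ, ‖g ξ‖ₑ ^ (ρ * (2 / (3 - ρ))) ∂intervalMeasure) ^ (3 - ρ) := by
  -- Fractional integration is applied to |g|^ρ, extended by zero, with γ = ρ - 1, which lies in
  -- (0,1) because 1 < ρ < 2.
  set u : ℝ → ℝ := (Set.Icc (-1 : ℝ) 1).indicator fun ξ => ‖g ξ‖ ^ ρ with hu
  have hum : Measurable u := Measurable.indicator (by fun_prop) measurableSet_Icc
  have hHLS := lintegral_lintegral_mul_rpow_abs_sub_le (γ := ρ - 1) (by linarith) (by linarith) hum
  have hs0 : 0 < 2 / (3 - ρ) := div_pos two_pos (by linarith)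
  rw [show 1 - (ρ - 1) = 2 - ρ by ring, show 2 - (ρ - 1) = 3 - ρ by ring] at hHLS
  have e1 : ∫⁻ η, ENNReal.ofReal (u η) ^ (2 / (3 - ρ)) =
      ∫⁻ ξ, ‖g ξ‖ₑ ^ (ρ * (2 / (3 - ρ))) ∂intervalMeasure := by
    rw [← lintegral_indicator measurableSet_Icc]
    congr 1; ext η
    by_cases hη : η ∈ Set.Icc (-1 : ℝ) 1
    · rw [hu, Set.indicator_of_mem hη, Set.indicator_of_mem hη, ← ofReal_norm,
        ← ENNReal.ofReal_rpow_of_nonneg (norm_nonneg _) (by linarith), ENNReal.rpow_mul]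
    · rw [hu, Set.indicator_of_notMem hη, Set.indicator_of_notMem hη, ENNReal.ofReal_zero,
        ENNReal.zero_rpow_of_pos hs0]
  rw [e1] at hHLS
  rw [ENNReal.ofReal_mul (by positivity), mul_assoc]
  refine le_trans ?_ (mul_le_mul_right hHLS _)
  rw [← lintegral_prod (μ := volume) (ν := volume) (fun z : ℝ × ℝ => ENNReal.ofReal (u z.1) *
      (ENNReal.ofReal (u z.2) * ENNReal.ofReal (|z.1 - z.2| ^ (-(ρ - 1)))))
    (Measurable.aemeasurable (by fun_prop)), ← Measure.volume_eq_prod,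
    ← lintegral_const_mul' _ _ ENNReal.ofReal_ne_top]
  refine le_trans ?_ (setLIntegral_le_lintegral openTriangle _)
  refine setLIntegral_mono' measurableSet_openTriangle ?_
  rintro ⟨ξ, η⟩ ⟨h1, h2, h3⟩
  simp only at h1 h2 h3 ⊢
  have hξ : ξ ∈ Set.Icc (-1 : ℝ) 1 := ⟨h1.le, by linarith⟩
  have hη : η ∈ Set.Icc (-1 : ℝ) 1 := ⟨by linarith, h3.le⟩
  have hd : 0 < |ξ - η| := abs_pos.2 (by linarith)
  have hpos : 0 < v * |ξ - η| := by positivity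
  simp only [hu, Set.indicator_of_mem hξ, Set.indicator_of_mem hη]
  rw [← ENNReal.ofReal_mul (by positivity), ← ENNReal.ofReal_mul (by positivity),
    ← ENNReal.ofReal_mul (by positivity)]
  refine ENNReal.ofReal_le_ofReal ?_
  -- The exponent 1 - ρ is negative, so the lower bound on the Jacobian becomes an upper bound. The
  -- curvature constant enters only here.
  have h4 : |φ η - φ ξ| ^ (1 - ρ) ≤ v ^ (1 - ρ) * |ξ - η| ^ (-(ρ - 1)) := by
    rw [show -(ρ - 1) = 1 - ρ by ring, ← Real.mul_rpow hv.le hd.le, abs_sub_comm (φ η)]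
    exact Real.rpow_le_rpow_of_nonpos hpos (hlow ξ hξ η hη) (by linarith)
  rw [norm_mul, Real.mul_rpow (norm_nonneg _) (norm_nonneg _)]
  calc _ ≤ ‖g ξ‖ ^ ρ * ‖g η‖ ^ ρ * (v ^ (1 - ρ) * |ξ - η| ^ (-(ρ - 1))) := by gcongr
    _ = _ := by ring

/-- The extension inequality on the scaling line, for measurable densities. -/
lemma exists_lintegral_intervalExtension_rpow_le {b : ℝ} (hb : 4 < b) (hv : 0 < v) :
    ∃ C : ℝ≥0, ∀ Ψ φ : ℝ → ℝ, Continuous φ → (∀ x, HasDerivAt Ψ (φ x) x) →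
      (∀ ξ ∈ Set.Icc (-1 : ℝ) 1, ∀ η ∈ Set.Icc (-1 : ℝ) 1, v * |ξ - η| ≤ |φ ξ - φ η|) →
      ∀ g : ℝ → ℂ, Measurable g → Integrable g intervalMeasure →
        ∫⁻ x, ‖intervalExtension Ψ g x‖ₑ ^ b ≤
          C * (∫⁻ ξ, ‖g ξ‖ₑ ^ (b / (b - 3)) ∂intervalMeasure) ^ (b - 3) := by
  set r : ℝ := b / 2 with hr
  set ρ : ℝ := b / (b - 2) with hρ
  have hb2 : 0 < b - 2 := by linarith
  have hb3 : 0 < b - 3 := by linarith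
  have hr2 : 2 < r := by rw [hr]; linarith
  have hρ1 : 1 < ρ := by rw [hρ, lt_div_iff₀ hb2]; linarith
  have hρ2 : ρ < 2 := by rw [hρ, div_lt_iff₀ hb2]; linarith
  have hρr : (ρ - 1) * (r - 1) = 1 := by rw [hρ, hr]; field_simp; ring
  have h3ρ : 3 - ρ = 2 * (b - 3) / (b - 2) := by rw [hρ]; field_simp; ring
  -- These two identities place the result on the scaling line: after a b-th root, the right side is
  -- a multiple of the norm of g in L^(b/(b-3)).
  have hq : ρ * (2 / (3 - ρ)) = b / (b - 3) := by rw [h3ρ, hρ]; field_simp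
  have hexp : (3 - ρ) * (r - 1) = b - 3 := by rw [h3ρ, hr]; field_simp
  set C1 : ℝ≥0∞ := ENNReal.ofReal (r * 4 * 2 ^ (r - 2) / (r - 2)) with hC1
  set C2 : ℝ≥0∞ := ENNReal.ofReal (v ^ (1 - ρ) * (2 * (2 / (2 - ρ) + 2 ^ ((ρ - 1) / 2)))) with hC2
  have hCtop : 2 ^ r * (C1 * C2 ^ (r - 1)) ≠ ⊤ :=
    ENNReal.mul_ne_top (ENNReal.rpow_ne_top_of_nonneg (by linarith) (by norm_num))
      (ENNReal.mul_ne_top ENNReal.ofReal_ne_top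
        (ENNReal.rpow_ne_top_of_nonneg (by linarith) ENNReal.ofReal_ne_top))
  refine ⟨(2 ^ r * (C1 * C2 ^ (r - 1))).toNNReal, fun Ψ φ hφ hΨ hlow g hgm hgi => ?_⟩
  rw [ENNReal.coe_toNNReal hCtop]
  have hΨm : Measurable Ψ :=
    (continuous_iff_continuousAt.2 fun x => (hΨ x).continuousAt).measurable
  have hΦm : Measurable (curveSum Ψ) := by unfold curveSum; fun_prop
  have hφm : Measurable φ := hφ.measurable
  set h : ℝ × ℝ → ℂ := fun z => g z.1 * g z.2 with hh
  have hhm : Measurable h := by fun_prop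
  have hTQ : openTriangle ⊆ Set.Icc (-1 : ℝ) 1 ×ˢ Set.Icc (-1 : ℝ) 1 := by
    rintro z ⟨h1, h2, h3⟩
    exact ⟨⟨h1.le, by linarith⟩, by linarith, h3.le⟩
  have hhi : Integrable h (volume.restrict openTriangle) := by
    have h1 := hgi.mul_prod hgi
    rw [Measure.prod_restrict, ← Measure.volume_eq_prod] at h1
    exact IntegrableOn.mono_set h1 hTQ
  have hdet : ∀ z ∈ openTriangle, 0 < |φ z.2 - φ z.1| := by
    intro z hz
    have h1 := hlow z.2 (hTQ hz).2 z.1 (hTQ hz).1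
    have : 0 < |z.2 - z.1| := abs_pos.2 (by linarith [hz.2.1])
    exact (mul_pos hv this).trans_le h1
  have hL2 : ∀ h : ℝ × ℝ → ℂ, Measurable h → Integrable h (volume.restrict openTriangle) →
      ∫⁻ x, ‖oscillatorySuperposition (volume.restrict openTriangle) (curveSum Ψ) h x‖ₑ ^ 2 ≤
        ∫⁻ z in openTriangle, ‖h z‖ₑ ^ 2 / ENNReal.ofReal |φ z.2 - φ z.1| := by
    intro h hm hi
    have := lintegral_oscillatorySuperposition_sq_le (Φ' := curveSumDeriv φ)
      measurableSet_openTriangle hΦm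
      (fun z _ => (hasFDerivAt_curveSum hΨ z).hasFDerivWithinAt) (injOn_curveSum hv hΨ hlow)
      (by simp_rw [det_curveSumDeriv]; fun_prop)
      (fun z hz => by rw [det_curveSumDeriv]; exact abs_pos.1 (hdet z hz)) hm hi
    simpa only [det_curveSumDeriv] using this
  have hHY := lintegral_oscillatorySuperposition_rpow_le hΦm (w := fun z => |φ z.2 - φ z.1|)
    (by fun_prop) ((ae_restrict_iff' measurableSet_openTriangle).2
      (Filter.Eventually.of_forall hdet)) hL2 hρ1 hr2 hρr hhm hhi
  have hE := lintegral_triangle_energy_le hv hlow hρ1 hρ2 hgm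
  rw [hq] at hE
  have hsq : ∀ x, ‖intervalExtension Ψ g x‖ₑ ^ b = 2 ^ r *
      ‖oscillatorySuperposition (volume.restrict openTriangle) (curveSum Ψ) h x‖ₑ ^ r := by
    intro x
    rw [show b = 2 * r by rw [hr]; ring, ENNReal.rpow_mul, ← ENNReal.mul_rpow_of_nonneg _ _
      (by linarith), ENNReal.rpow_two, ← enorm_pow, intervalExtension_sq hΨm hgi, enorm_mul]
    congr 2
    rw [← ofReal_norm]; simp
  simp_rw [hsq]
  rw [lintegral_const_mul' _ _ (ENNReal.rpow_ne_top_of_nonneg (by linarith) (by norm_num)),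
    mul_assoc, mul_assoc]
  gcongr
  refine hHY.trans ?_
  gcongr
  refine (ENNReal.rpow_le_rpow hE (by linarith)).trans_eq ?_
  rw [ENNReal.mul_rpow_of_nonneg _ _ (by linarith), ← ENNReal.rpow_mul, hexp]

end

/-! ### Sufficiency for all admissible exponents -/

/-- The extension inequality, with a constant depending on the phase only through the lower bound
for the curvature. -/
theorem exists_extensionBound {p' q' : ℝ≥0∞} (hq' : 1 ≤ q') {v : ℝ} (hv : 0 < v)
    (hp4 : 4 < p') (hpq : 3 / p' + 1 / q' ≤ 1) :
    ∃ C : ℝ≥0, ∀ ψ : ℝ → ℝ, CurvatureBoundedBelow v ψ → ExtensionBound ψ q' p' C := by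
  have hvol : intervalMeasure Set.univ = 2 := by
    rw [Measure.restrict_apply_univ, Real.volume_Icc]; norm_num
  have hfin : IsFiniteMeasure intervalMeasure := ⟨by rw [hvol]; norm_num⟩
  -- It suffices to treat measurable densities and some smaller exponent a: Hölder on an interval of
  -- length 2 costs only a power of 2.
  have htr : ∀ a : ℝ≥0∞, 1 ≤ a → a ≤ q' → ∀ C : ℝ≥0, (∀ ψ : ℝ → ℝ, CurvatureBoundedBelow v ψ →
      ∀ g : ℝ → ℂ, Measurable g → Integrable g intervalMeasure →
        eLpNorm (intervalExtension ψ g) p' volume ≤ C * eLpNorm g a intervalMeasure) →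
      ∃ C : ℝ≥0, ∀ ψ : ℝ → ℝ, CurvatureBoundedBelow v ψ → ExtensionBound ψ q' p' C := by
    intro a ha haq C hC
    have h2top : (2 : ℝ≥0∞) ^ (1 / a.toReal - 1 / q'.toReal) ≠ ⊤ :=
      ENNReal.rpow_ne_top_of_ne_zero (by norm_num) (by norm_num)
    refine ⟨C * ((2 : ℝ≥0∞) ^ (1 / a.toReal - 1 / q'.toReal)).toNNReal, fun ψ hψ => ?_⟩
    rw [extensionBound_iff hψ.continuousOn]
    intro g hg
    obtain ⟨g', hg'm, hgg'⟩ := hg.1.aemeasurable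
    rw [intervalExtension_congr_ae hgg', eLpNorm_congr_ae hgg']
    have hg' : MemLp g' q' intervalMeasure := (memLp_congr_ae hgg').1 hg
    refine (hC ψ hψ g' hg'm (memLp_one_iff_integrable.1 (hg'.mono_exponent hq'))).trans ?_
    rw [ENNReal.coe_mul, ENNReal.coe_toNNReal h2top, mul_assoc]
    gcongr
    refine (eLpNorm_le_eLpNorm_mul_rpow_measure_univ haq hg'.1).trans_eq ?_
    rw [hvol, mul_comm]
  rcases eq_or_ne p' ⊤ with rfl | hptop
  · refine htr 1 le_rfl hq' 1 fun ψ _ g hgm hgi => ?_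
    rw [eLpNorm_exponent_top, ENNReal.coe_one, one_mul, eLpNorm_one_eq_lintegral_enorm]
    refine eLpNormEssSup_le_of_ae_enorm_bound (Filter.Eventually.of_forall fun x => ?_)
    refine (enorm_integral_le_lintegral_enorm _).trans_eq ?_
    congr 1; ext z
    rw [enorm_mul, ← ofReal_norm (unitPhase _), norm_unitPhase]; simp
  · set b := p'.toReal with hb
    have hpb : p' = ENNReal.ofReal b := (ENNReal.ofReal_toReal hptop).symm
    have hb4 : 4 < b := by
      have := (ENNReal.toReal_lt_toReal (by norm_num) hptop).2 hp4
      simpa using this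
    have hb3 : 0 < b - 3 := by linarith
    obtain ⟨C, hC⟩ := exists_lintegral_intervalExtension_rpow_le hb4 hv
    have hq0 : 0 < b / (b - 3) := by positivity
    have h1q : 1 ≤ b / (b - 3) := by rw [le_div_iff₀ hb3]; linarith
    -- For finite p' the condition 3/p' + 1/q' ≤ 1 says precisely that q' is at least the exponent
    -- on the scaling line.
    have haq : ENNReal.ofReal (b / (b - 3)) ≤ q' := by
      rcases eq_or_ne q' ⊤ with rfl | hqtop
      · exact le_top
      · set c := q'.toReal with hc
        have hqc : q' = ENNReal.ofReal c := (ENNReal.ofReal_toReal hqtop).symm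
        have hc1 : 1 ≤ c := by
          have := (ENNReal.toReal_le_toReal (by norm_num) hqtop).2 hq'
          simpa using this
        rw [hpb, hqc] at hpq
        rw [hqc]
        refine ENNReal.ofReal_le_ofReal ?_
        rw [← ENNReal.ofReal_ofNat (n := 3), ← ENNReal.ofReal_one,
          ← ENNReal.ofReal_div_of_pos (by linarith), ← ENNReal.ofReal_div_of_pos (by linarith),
          ← ENNReal.ofReal_add (by positivity) (by positivity),
          ENNReal.ofReal_le_ofReal_iff (by norm_num)] at hpq
        rw [div_le_iff₀ hb3]
        have hb0 : 0 < b := by linarith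
        have hc0 : 0 < c := by linarith
        rw [div_add_div _ _ hb0.ne' hc0.ne', div_le_one (by positivity)] at hpq
        linarith
    refine htr _ (by rw [← ENNReal.ofReal_one]; exact ENNReal.ofReal_le_ofReal h1q) haq
      (C ^ (1 / b)) fun ψ hψ g hgm hgi => ?_
    obtain ⟨Ψ, φ, hφ, hΨ, heq, hlow, -⟩ := hψ.exists_extension
    rw [intervalExtension_congr_phase heq]
    have hmain := hC Ψ φ hφ hΨ hlow g hgm hgi
    rw [hpb, eLpNorm_eq_lintegral_rpow_enorm_toReal (by simp; linarith) ENNReal.ofReal_ne_top,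
      eLpNorm_eq_lintegral_rpow_enorm_toReal (by simp; exact hq0) ENNReal.ofReal_ne_top,
      ENNReal.toReal_ofReal (by linarith), ENNReal.toReal_ofReal hq0.le]
    refine (ENNReal.rpow_le_rpow hmain (by positivity)).trans_eq ?_
    rw [ENNReal.mul_rpow_of_nonneg _ _ (by positivity), ENNReal.coe_rpow_of_nonneg _ (by positivity),
      ← ENNReal.rpow_mul]
    congr 2
    field_simp

/-! ### Necessity of p' > 4: the extension of the constant 1 -/

lemma stronglyMeasurable_intervalExtension {Ψ : ℝ → ℝ} (hΨ : Measurable Ψ) {g : ℝ → ℂ}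
    (hg : Measurable g) : StronglyMeasurable (intervalExtension Ψ g) := by
  unfold intervalExtension
  refine StronglyMeasurable.integral_prod_right'
    (f := fun p : (ℝ × ℝ) × ℝ => g p.2 * unitPhase (p.1.1 * p.2 + p.1.2 * Ψ p.2)) ?_
  exact Measurable.stronglyMeasurable (by fun_prop)

/-- A Gaussian mean of an oscillating kernel stays bounded below when the oscillation is slow at
the scale of the Gaussian. -/
lemma exp_neg_pi_div_two_le_integral_cos_mul_gaussian {ε M y : ℝ} (hε : 0 < ε) (hε1 : ε ≤ 1)
    {Ψ : ℝ → ℝ} (hΨ : Continuous Ψ)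
    (hLip : ∀ ξ ∈ Set.Icc (-1 : ℝ) 1, ∀ η ∈ Set.Icc (-1 : ℝ) 1, |Ψ ξ - Ψ η| ≤ M * |ξ - η|)
    (hsmall : √2 * (2 * Real.pi ^ 2 * (y * M * ε) ^ 2) ≤ Real.exp (-Real.pi) / 2)
    {ξ : ℝ} (hξ : ξ ∈ Set.Icc (-1 : ℝ) 1) :
    Real.exp (-Real.pi) / 2 ≤ ∫ η, Real.cos (2 * Real.pi * (y * (Ψ ξ - Ψ η))) *
      (ε⁻¹ * Real.exp (-(Real.pi / ε ^ 2) * (ξ - η) ^ 2)) ∂intervalMeasure := by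
  set k : ℝ → ℝ := fun η => ε⁻¹ * Real.exp (-(Real.pi / ε ^ 2) * (ξ - η) ^ 2) with hk
  set k₂ : ℝ → ℝ := fun η => ε⁻¹ * Real.exp (-(Real.pi / (2 * ε ^ 2)) * (ξ - η) ^ 2) with hk₂
  -- With this δ, the inequality 1 - cos x ≤ x²/2 and the Lipschitz bound give 1 - cos ≤ δ(ξ-η)²/ε².
  set δ : ℝ := 2 * Real.pi ^ 2 * (y * M * ε) ^ 2 with hδ
  have hδ0 : 0 ≤ δ := by positivity
  have hcont : ∀ f : ℝ → ℝ, Continuous f → Integrable f intervalMeasure := fun f hf =>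
    hf.continuousOn.integrableOn_Icc
  have hkc : Continuous k := by fun_prop
  have hk2c : Continuous k₂ := by fun_prop
  have hpt : ∀ η ∈ Set.Icc (-1 : ℝ) 1, k η - δ * k₂ η ≤
      Real.cos (2 * Real.pi * (y * (Ψ ξ - Ψ η))) * k η := by
    intro η hη
    set s : ℝ := (ξ - η) ^ 2 / ε ^ 2 with hs
    have hs0 : 0 ≤ s := by positivity
    have h1 : 1 - (2 * Real.pi * (y * (Ψ ξ - Ψ η))) ^ 2 / 2 ≤
        Real.cos (2 * Real.pi * (y * (Ψ ξ - Ψ η))) := Real.one_sub_sq_div_two_le_cos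
    have h2 : (2 * Real.pi * (y * (Ψ ξ - Ψ η))) ^ 2 / 2 ≤ δ * s := by
      have h3 : (Ψ ξ - Ψ η) ^ 2 ≤ M ^ 2 * (ξ - η) ^ 2 := by
        rw [← sq_abs, ← sq_abs (ξ - η), ← mul_pow]
        exact pow_le_pow_left₀ (abs_nonneg _) (hLip ξ hξ η hη) 2
      have h4 : δ * s = 2 * Real.pi ^ 2 * y ^ 2 * (M ^ 2 * (ξ - η) ^ 2) := by
        rw [hδ, hs]; field_simp
      rw [h4]
      calc _ = 2 * Real.pi ^ 2 * y ^ 2 * (Ψ ξ - Ψ η) ^ 2 := by ring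
        _ ≤ _ := by gcongr
    -- The quadratic factor is absorbed by half of the Gaussian's exponent, at the price of the
    -- wider Gaussian `k₂`.
    have h5 : s * k η ≤ k₂ η := by
      have e1 : k η = ε⁻¹ * (Real.exp (-(Real.pi / 2 * s)) * Real.exp (-(Real.pi / 2 * s))) := by
        rw [← Real.exp_add]
        simp only [hk]; congr 2; rw [hs]; field_simp; ring
      have e2 : k₂ η = ε⁻¹ * Real.exp (-(Real.pi / 2 * s)) := by
        simp only [hk₂]; congr 2; rw [hs]; field_simp
      have h6 : s * Real.exp (-(Real.pi / 2 * s)) ≤ 1 := by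
        rw [Real.exp_neg, ← div_eq_mul_inv, div_le_one (Real.exp_pos _)]
        have := Real.add_one_le_exp (Real.pi / 2 * s)
        nlinarith [Real.pi_gt_three]
      rw [e1, e2]
      calc _ = ε⁻¹ * Real.exp (-(Real.pi / 2 * s)) * (s * Real.exp (-(Real.pi / 2 * s))) := by ring
        _ ≤ ε⁻¹ * Real.exp (-(Real.pi / 2 * s)) * 1 := by gcongr
        _ = _ := mul_one _
    have hk0 : 0 ≤ k η := by simp only [hk]; positivity
    calc k η - δ * k₂ η ≤ k η - δ * (s * k η) := by gcongr
      _ = (1 - δ * s) * k η := by ring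
      _ ≤ _ := by gcongr; linarith
  have hJ : Real.exp (-Real.pi) ≤ ∫ η, k η ∂intervalMeasure := by
    -- An interval of length ε starting or ending at ξ, on the side that stays in [-1,1]. On it the
    -- kernel is at least ε⁻¹e^(-π), even when ξ is an end point.
    obtain ⟨c, hc1, hc2, hc3, hc4⟩ : ∃ c : ℝ, -1 ≤ c ∧ c + ε ≤ 1 ∧ ξ - ε ≤ c ∧ c ≤ ξ := by
      rcases le_total ξ 0 with h | h
      · exact ⟨ξ, hξ.1, by linarith, by linarith, le_rfl⟩
      · exact ⟨ξ - ε, by linarith, by linarith [hξ.2], le_rfl, by linarith⟩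
    have hsub : Set.Icc c (c + ε) ⊆ Set.Icc (-1 : ℝ) 1 := Set.Icc_subset_Icc hc1 hc2
    have h1 : ∫ η in Set.Icc c (c + ε), k η ≤ ∫ η, k η ∂intervalMeasure :=
      setIntegral_mono_set (hcont k hkc) (Filter.Eventually.of_forall fun η => by
        simp only [hk, Pi.zero_apply]; positivity) (Filter.Eventually.of_forall hsub)
    refine le_trans ?_ h1
    have h2 : ∫ η in Set.Icc c (c + ε), ε⁻¹ * Real.exp (-Real.pi) = Real.exp (-Real.pi) := by
      rw [setIntegral_const, Measure.real, Real.volume_Icc, add_sub_cancel_left,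
        ENNReal.toReal_ofReal hε.le, smul_eq_mul, mul_inv_cancel_left₀ hε.ne']
    rw [← h2]
    refine setIntegral_mono_on (continuous_const.continuousOn.integrableOn_Icc)
      (hkc.continuousOn.integrableOn_Icc) measurableSet_Icc fun η hη => ?_
    simp only [hk]
    gcongr
    have h3 : (ξ - η) ^ 2 ≤ ε ^ 2 := sq_le_sq' (by linarith [hη.2]) (by linarith [hη.1])
    have h4 : Real.pi / ε ^ 2 * (ξ - η) ^ 2 ≤ Real.pi / ε ^ 2 * ε ^ 2 := by gcongr
    rw [div_mul_cancel₀ _ (by positivity)] at h4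
    linarith
  have hK : ∫ η, k₂ η ∂intervalMeasure ≤ √2 := by
    have h0 : Integrable (fun t : ℝ => ε⁻¹ * Real.exp (-(Real.pi / (2 * ε ^ 2)) * t ^ 2)) :=
      (integrable_exp_neg_mul_sq (by positivity)).const_mul _
    have hi : Integrable k₂ := h0.comp_sub_left ξ
    refine (setIntegral_le_integral hi (Filter.Eventually.of_forall fun η => by
      simp only [hk₂, Pi.zero_apply]; positivity)).trans_eq ?_
    rw [hk₂, integral_sub_left_eq_self
      (fun t : ℝ => ε⁻¹ * Real.exp (-(Real.pi / (2 * ε ^ 2)) * t ^ 2)) volume ξ,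
      integral_const_mul, integral_gaussian]
    have : Real.pi / (Real.pi / (2 * ε ^ 2)) = 2 * ε ^ 2 := by
      have := Real.pi_ne_zero
      field_simp
    rw [this, Real.sqrt_mul (by norm_num), Real.sqrt_sq hε.le]
    field_simp
  calc Real.exp (-Real.pi) / 2 ≤ (∫ η, k η ∂intervalMeasure) - δ * ∫ η, k₂ η ∂intervalMeasure := by
        have := mul_le_mul_of_nonneg_left hK hδ0
        linarith
    _ = ∫ η, (k η - δ * k₂ η) ∂intervalMeasure := by
        rw [integral_sub (hcont _ hkc) (hcont _ (by fun_prop)), integral_const_mul δ k₂]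
    _ ≤ _ := setIntegral_mono_on (hcont _ (by fun_prop)) (hcont _ (by fun_prop))
        measurableSet_Icc hpt

/-- The square mean of the extension of `1` along a horizontal line, seen through a Gaussian. -/
lemma exp_neg_pi_le_integral_gaussian_mul_sq {ε M y : ℝ} (hε : 0 < ε) (hε1 : ε ≤ 1)
    {Ψ : ℝ → ℝ} (hΨ : Continuous Ψ)
    (hLip : ∀ ξ ∈ Set.Icc (-1 : ℝ) 1, ∀ η ∈ Set.Icc (-1 : ℝ) 1, |Ψ ξ - Ψ η| ≤ M * |ξ - η|)
    (hsmall : √2 * (2 * Real.pi ^ 2 * (y * M * ε) ^ 2) ≤ Real.exp (-Real.pi) / 2) :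
    Real.exp (-Real.pi) ≤ ∫ x : ℝ, Real.exp (-(Real.pi * ε ^ 2) * x ^ 2) *
      ‖intervalExtension Ψ (fun _ => 1) (x, y)‖ ^ 2 := by
  have hh : Integrable (fun ξ => unitPhase (y * Ψ ξ)) intervalMeasure :=
    (Continuous.continuousOn (by fun_prop)).integrableOn_Icc
  have h1 := integral_mul_norm_sq_superposition (ν := volume) hh
    (integrable_exp_neg_mul_sq (b := Real.pi * ε ^ 2) (by positivity))
    (a := fun x ξ => unitPhase (x * ξ)) (by unfold Function.uncurry; fun_prop)
    (fun x z => norm_unitPhase _)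
  have h2 : ∀ x : ℝ, intervalExtension Ψ (fun _ => 1) (x, y) =
      ∫ z, unitPhase (y * Ψ z) * unitPhase (x * z) ∂intervalMeasure := by
    intro x
    unfold intervalExtension
    congr 1; ext ξ
    rw [one_mul, add_comm, unitPhase_add]
  simp_rw [← h2] at h1
  set F : ℝ × ℝ → ℂ := fun z => unitPhase (y * (Ψ z.1 - Ψ z.2)) *
    ((ε⁻¹ * Real.exp (-(Real.pi / ε ^ 2) * (z.1 - z.2) ^ 2) : ℝ) : ℂ) with hF
  have h3 : ((∫ x : ℝ, Real.exp (-(Real.pi * ε ^ 2) * x ^ 2) *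
      ‖intervalExtension Ψ (fun _ => 1) (x, y)‖ ^ 2 : ℝ) : ℂ) =
      ∫ z, F z ∂(intervalMeasure.prod intervalMeasure) := by
    rw [h1]
    congr 1; ext z
    simp only [hF]
    rw [← integral_gaussian_mul_unitPhase hε, conj_unitPhase, ← unitPhase_add]
    congr 2
    · ring_nf
    · ext x
      rw [conj_unitPhase, ← unitPhase_add]
      congr 2; ring
  have hFc : Continuous F := by fun_prop
  have hFi : Integrable F (intervalMeasure.prod intervalMeasure) := by
    rw [Measure.prod_restrict]
    exact hFc.continuousOn.integrableOn_compact (isCompact_Icc.prod isCompact_Icc)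
  have h4 := congrArg Complex.re h3
  rw [Complex.ofReal_re] at h4
  rw [h4, ← RCLike.re_eq_complex_re, ← integral_re hFi, integral_prod _ hFi.re]
  have h5 : ∀ ξ η, RCLike.re (F (ξ, η)) = Real.cos (2 * Real.pi * (y * (Ψ ξ - Ψ η))) *
      (ε⁻¹ * Real.exp (-(Real.pi / ε ^ 2) * (ξ - η) ^ 2)) := by
    intro ξ η
    simp only [hF]
    rw [RCLike.re_eq_complex_re, Complex.re_mul_ofReal, re_unitPhase]
  have h6 : ∫ _ξ, Real.exp (-Real.pi) / 2 ∂intervalMeasure = Real.exp (-Real.pi) := by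
    rw [setIntegral_const, Measure.real, Real.volume_Icc]; norm_num; ring
  rw [← h6]
  refine setIntegral_mono_on (continuous_const.continuousOn.integrableOn_Icc)
    hFi.re.integral_prod_left measurableSet_Icc fun ξ hξ => ?_
  simp_rw [h5]
  exact exp_neg_pi_div_two_le_integral_cos_mul_gaussian hε hε1 hΨ hLip hsmall hξ

/-- The fourth-power mean of the extension of `1` along a horizontal line. -/
lemma ofReal_le_lintegral_intervalExtension_one_pow_four {ε M y : ℝ} (hε : 0 < ε) (hε1 : ε ≤ 1)
    {Ψ : ℝ → ℝ} (hΨ : Continuous Ψ)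
    (hLip : ∀ ξ ∈ Set.Icc (-1 : ℝ) 1, ∀ η ∈ Set.Icc (-1 : ℝ) 1, |Ψ ξ - Ψ η| ≤ M * |ξ - η|)
    (hsmall : √2 * (2 * Real.pi ^ 2 * (y * M * ε) ^ 2) ≤ Real.exp (-Real.pi) / 2) :
    ENNReal.ofReal (Real.exp (-Real.pi) ^ 2 * ε) ≤
      ∫⁻ x : ℝ, ‖intervalExtension Ψ (fun _ => 1) (x, y)‖ₑ ^ (4 : ℝ) := by
  set G : ℝ → ℂ := fun x => intervalExtension Ψ (fun _ => 1) (x, y) with hG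
  have hGm : Measurable G :=
    (stronglyMeasurable_intervalExtension hΨ.measurable measurable_const).measurable.comp
      (by fun_prop)
  have h1 := exp_neg_pi_le_integral_gaussian_mul_sq hε hε1 hΨ hLip hsmall
  set k : ℝ → ℝ := fun x => Real.exp (-(Real.pi * ε ^ 2) * x ^ 2) with hk
  have hkm : Measurable k := by fun_prop
  have h2 : ENNReal.ofReal (Real.exp (-Real.pi)) ≤
      ∫⁻ x, (‖G x‖ₑ ^ (2 : ℝ)) * ENNReal.ofReal (k x) := by
    refine (ENNReal.ofReal_le_ofReal h1).trans ?_
    have hm2 : Measurable fun x => k x * ‖G x‖ ^ 2 := by fun_prop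
    change ENNReal.ofReal (∫ x, k x * ‖G x‖ ^ 2) ≤ _
    rw [integral_eq_lintegral_of_nonneg_ae (Filter.Eventually.of_forall fun x =>
      mul_nonneg (Real.exp_pos _).le (by positivity)) hm2.aestronglyMeasurable]
    refine ENNReal.ofReal_toReal_le.trans_eq ?_
    congr 1; ext x
    rw [ENNReal.ofReal_mul (Real.exp_pos _).le, mul_comm, ENNReal.ofReal_pow (norm_nonneg _),
      ofReal_norm, ENNReal.rpow_two]
  -- Cauchy–Schwarz against the window, whose square has integral at most 1/ε. Squaring the outcome
  -- yields the lower bound e^(-2π)ε.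
  have h3 := ENNReal.lintegral_mul_le_Lp_mul_Lq volume (p := 2) (q := 2)
    (Real.HolderConjugate.two_two) (f := fun x => ‖G x‖ₑ ^ (2 : ℝ))
    (g := fun x => ENNReal.ofReal (k x)) (by fun_prop) (by fun_prop)
  have h4 : ∫⁻ x, ENNReal.ofReal (k x) ^ (2 : ℝ) ≤ ENNReal.ofReal ε⁻¹ := by
    have e1 : ∀ x, ENNReal.ofReal (k x) ^ (2 : ℝ) =
        ENNReal.ofReal (Real.exp (-(2 * Real.pi * ε ^ 2) * x ^ 2)) := by
      intro x
      rw [ENNReal.rpow_two, ← ENNReal.ofReal_pow (Real.exp_pos _).le, ← Real.exp_nat_mul]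
      congr 2; push_cast; ring
    simp_rw [e1]
    rw [← ofReal_integral_eq_lintegral_ofReal (integrable_exp_neg_mul_sq (by positivity))
      (Filter.Eventually.of_forall fun x => (Real.exp_pos _).le), integral_gaussian]
    refine ENNReal.ofReal_le_ofReal (Real.sqrt_le_iff.2 ⟨by positivity, ?_⟩)
    have := Real.pi_pos
    rw [inv_pow, div_le_iff₀ (by positivity)]
    field_simp
    norm_num
  have h5 : ∫⁻ x, (‖G x‖ₑ ^ (2 : ℝ)) ^ (2 : ℝ) = ∫⁻ x, ‖G x‖ₑ ^ (4 : ℝ) := by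
    congr 1; ext x
    rw [← ENNReal.rpow_mul]; norm_num
  rw [h5] at h3
  set I : ℝ≥0∞ := ∫⁻ x, ‖G x‖ₑ ^ (4 : ℝ) with hI
  have h6 : ENNReal.ofReal (Real.exp (-Real.pi)) ≤ I ^ (1 / 2 : ℝ) * ENNReal.ofReal ε⁻¹ ^ (1 / 2 : ℝ) := by
    refine h2.trans (h3.trans ?_)
    gcongr
  have h7 := ENNReal.rpow_le_rpow h6 (z := 2) (by norm_num)
  rw [← ENNReal.mul_rpow_of_nonneg _ _ (by norm_num), ← ENNReal.rpow_mul,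
    show (1 / 2 : ℝ) * 2 = 1 by norm_num, ENNReal.rpow_one, ENNReal.rpow_two,
    ← ENNReal.ofReal_pow (Real.exp_pos _).le] at h7
  rw [ENNReal.ofReal_mul (by positivity)]
  refine (mul_le_mul_left h7 _).trans_eq ?_
  rw [mul_assoc, ← ENNReal.ofReal_mul (by positivity), inv_mul_cancel₀ hε.ne', ENNReal.ofReal_one,
    mul_one]

/-- The extension of `1` is not in `L⁴`. -/
lemma lintegral_intervalExtension_one_pow_four {Ψ φ : ℝ → ℝ} (hφ : Continuous φ)
    (hΨ : ∀ x, HasDerivAt Ψ (φ x) x) :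
    ∫⁻ x, ‖intervalExtension Ψ (fun _ => 1) x‖ₑ ^ (4 : ℝ) = ⊤ := by
  have hΨc : Continuous Ψ := continuous_iff_continuousAt.2 fun x => (hΨ x).continuousAt
  obtain ⟨M₀, hM₀⟩ := isCompact_Icc.exists_bound_of_continuousOn
    (hφ.continuousOn (s := Set.Icc (-1 : ℝ) 1))
  set M : ℝ := max M₀ 1 with hM
  have hM1 : 0 < M := by positivity
  have hLip : ∀ ξ ∈ Set.Icc (-1 : ℝ) 1, ∀ η ∈ Set.Icc (-1 : ℝ) 1, |Ψ ξ - Ψ η| ≤ M * |ξ - η| := by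
    intro ξ hξ η hη
    exact (convex_Icc (-1 : ℝ) 1).norm_image_sub_le_of_norm_hasDerivWithin_le
      (fun x _ => (hΨ x).hasDerivWithinAt) (fun x hx => (hM₀ x hx).trans (le_max_left _ _)) hη hξ
  -- At height y the scale is ε = θ/y, so yMε = Mθ is independent of y. This θ meets the smallness
  -- condition, and the +1 in the denominator keeps θ ≤ 1.
  set θ : ℝ := Real.exp (-Real.pi) / (2 * (√2 * (2 * Real.pi ^ 2 * M ^ 2)) + 1) with hθ
  have hD : 0 < √2 * (2 * Real.pi ^ 2 * M ^ 2) := by positivity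
  have hθ0 : 0 < θ := by positivity
  have hexp1 : Real.exp (-Real.pi) ≤ 1 := Real.exp_le_one_iff.2 (by linarith [Real.pi_pos])
  have hθ1 : θ ≤ 1 := by
    rw [hθ, div_le_one (by positivity)]; linarith
  have hθs : √2 * (2 * Real.pi ^ 2 * M ^ 2) * θ ≤ Real.exp (-Real.pi) / 2 := by
    rw [hθ, mul_div_assoc', div_le_div_iff₀ (by positivity) (by norm_num)]
    nlinarith [Real.exp_pos (-Real.pi)]
  have hline : ∀ y ∈ Set.Ioi (1 : ℝ), ENNReal.ofReal (Real.exp (-Real.pi) ^ 2 * θ) *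
      ENNReal.ofReal y⁻¹ ≤
      ∫⁻ x : ℝ, ‖intervalExtension Ψ (fun _ => 1) (x, y)‖ₑ ^ (4 : ℝ) := by
    intro y hy
    have hy1 : (1 : ℝ) < y := hy
    have hy0 : 0 < y := by linarith
    rw [← ENNReal.ofReal_mul (by positivity), mul_assoc]
    refine ofReal_le_lintegral_intervalExtension_one_pow_four (M := M) (ε := θ * y⁻¹)
      (by positivity) ?_ hΨc hLip ?_
    · calc θ * y⁻¹ ≤ 1 * 1 := by
            gcongr
            exact inv_le_one_of_one_le₀ hy1.le
        _ = 1 := by norm_num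
    · have e : (y * M * (θ * y⁻¹)) ^ 2 = M ^ 2 * (θ * θ) := by field_simp
      rw [e]
      calc √2 * (2 * Real.pi ^ 2 * (M ^ 2 * (θ * θ))) =
          √2 * (2 * Real.pi ^ 2 * M ^ 2) * θ * θ := by ring
        _ ≤ √2 * (2 * Real.pi ^ 2 * M ^ 2) * θ * 1 := by gcongr
        _ ≤ _ := by linarith
  have hsm := stronglyMeasurable_intervalExtension hΨc.measurable (g := fun _ => 1)
    measurable_const
  have hinv : ∫⁻ y in Set.Ioi (1 : ℝ), ENNReal.ofReal y⁻¹ = ⊤ := by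
    by_contra hne
    refine not_integrableOn_Ioi_inv (a := 1) ⟨measurable_inv.aestronglyMeasurable, ?_⟩
    rw [hasFiniteIntegral_iff_ofReal]
    · exact lt_top_iff_ne_top.2 hne
    · filter_upwards [ae_restrict_mem measurableSet_Ioi] with y hy
      exact inv_nonneg.2 (zero_le_one.trans (le_of_lt hy))
  rw [Measure.volume_eq_prod, lintegral_prod_symm _ (hsm.measurable.enorm.pow_const _).aemeasurable,
    eq_top_iff]
  refine le_trans ?_ (setLIntegral_le_lintegral (Set.Ioi (1 : ℝ)) _)
  refine le_trans ?_ (setLIntegral_mono' measurableSet_Ioi hline)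
  rw [lintegral_const_mul' _ _ ENNReal.ofReal_ne_top, hinv, ENNReal.mul_top]
  rw [Ne, ENNReal.ofReal_eq_zero, not_le]; positivity

/-- The extension of 1 is bounded by 2, so a finite norm for some exponent at most 4 would force a
finite L⁴ norm. -/
lemma four_lt_of_eLpNorm_intervalExtension_one {Ψ φ : ℝ → ℝ} (hφ : Continuous φ)
    (hΨ : ∀ x, HasDerivAt Ψ (φ x) x) {p' : ℝ≥0∞} (hp : 1 ≤ p')
    (h : eLpNorm (intervalExtension Ψ fun _ => 1) p' volume ≠ ⊤) : 4 < p' := by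
  by_contra hle
  rw [not_lt] at hle
  have hΨc : Continuous Ψ := continuous_iff_continuousAt.2 fun x => (hΨ x).continuousAt
  have hptop : p' ≠ ⊤ := ne_top_of_le_ne_top (by norm_num) hle
  set b := p'.toReal with hb
  have hb1 : 1 ≤ b := by simpa using (ENNReal.toReal_le_toReal (by norm_num) hptop).2 hp
  have hb4 : b ≤ 4 := by simpa using (ENNReal.toReal_le_toReal hptop (by norm_num)).2 hle
  have hfin := (eLpNorm_lt_top_iff_lintegral_rpow_enorm_lt_top
    (zero_lt_one.trans_le hp).ne' hptop).1 (lt_top_iff_ne_top.2 h)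
  rw [← hb] at hfin
  have hbd : ∀ x, ‖intervalExtension Ψ (fun _ => 1) x‖ₑ ≤ 2 := by
    intro x
    refine (enorm_integral_le_lintegral_enorm _).trans ?_
    have : ∀ ξ : ℝ, ‖(1 : ℂ) * unitPhase (x.1 * ξ + x.2 * Ψ ξ)‖ₑ = 1 := by
      intro ξ
      rw [one_mul, ← ofReal_norm, norm_unitPhase, ENNReal.ofReal_one]
    simp_rw [this]
    rw [lintegral_const, Measure.restrict_apply_univ, Real.volume_Icc]
    norm_num
  have hle4 : ∫⁻ x, ‖intervalExtension Ψ (fun _ => 1) x‖ₑ ^ (4 : ℝ) ≤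
      2 ^ (4 - b) * ∫⁻ x, ‖intervalExtension Ψ (fun _ => 1) x‖ₑ ^ b := by
    rw [← lintegral_const_mul' _ _ (ENNReal.rpow_ne_top_of_nonneg (by linarith) (by norm_num))]
    refine lintegral_mono fun x => ?_
    rw [show (4 : ℝ) = (4 - b) + b by ring, ENNReal.rpow_add_of_nonneg _ _ (by linarith)
      (by linarith), show (4 - b + b - b) = 4 - b by ring]
    gcongr
    exact hbd x
  rw [lintegral_intervalExtension_one_pow_four hφ hΨ, top_le_iff] at hle4
  exact ENNReal.mul_ne_top (ENNReal.rpow_ne_top_of_nonneg (by linarith) (by norm_num)) hfin.ne hle4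

/-! ### Necessity of the scaling condition: caps -/

/-- The indicator function of the cap `[-δ, δ]`. -/
def capIndicator (δ : ℝ) : ℝ → ℂ := (Set.Icc (-δ) δ).indicator fun _ => 1

/-- The parallelogram dual to the cap `[-δ, δ]` of a curve with slope `m` at the origin. -/
def dualRegion (c m δ : ℝ) : Set (ℝ × ℝ) := {x | |x.1 + x.2 * m| ≤ c / δ ∧ |x.2| ≤ c / δ ^ 2}

lemma measurableSet_dualRegion (c m δ : ℝ) : MeasurableSet (dualRegion c m δ) :=
  (measurableSet_le (f := fun x : ℝ × ℝ => |x.1 + x.2 * m|) (by fun_prop) measurable_const).inter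
    (measurableSet_le (f := fun x : ℝ × ℝ => |x.2|) (by fun_prop) measurable_const)

lemma volume_dualRegion {c m δ : ℝ} (hc : 0 < c) (hδ : 0 < δ) :
    volume (dualRegion c m δ) = ENNReal.ofReal (4 * c ^ 2 / δ ^ 3) := by
  rw [Measure.volume_eq_prod, Measure.prod_apply_symm (measurableSet_dualRegion c m δ)]
  have h1 : ∀ y : ℝ, volume ((fun x => (x, y)) ⁻¹' dualRegion c m δ) =
      (Set.Icc (-(c / δ ^ 2)) (c / δ ^ 2)).indicator (fun _ => ENNReal.ofReal (2 * (c / δ))) y := by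
    intro y
    by_cases hy : y ∈ Set.Icc (-(c / δ ^ 2)) (c / δ ^ 2)
    · rw [Set.indicator_of_mem hy]
      have : (fun x => (x, y)) ⁻¹' dualRegion c m δ =
          Set.Icc (-(y * m) - c / δ) (-(y * m) + c / δ) := by
        ext x
        simp only [dualRegion, Set.mem_preimage, Set.mem_ofPred_eq, abs_le, Set.mem_Icc]
        constructor
        · rintro ⟨⟨h1, h2⟩, -⟩; constructor <;> linarith
        · rintro ⟨h1, h2⟩; exact ⟨⟨by linarith, by linarith⟩, hy⟩
      rw [this, Real.volume_Icc]; congr 1; ring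
    · rw [Set.indicator_of_notMem hy]
      have : (fun x => (x, y)) ⁻¹' dualRegion c m δ = ∅ := by
        ext x
        simp only [dualRegion, Set.mem_preimage, Set.mem_ofPred_eq, Set.mem_empty_iff_false,
          iff_false, not_and]
        intro _ h
        exact hy (abs_le.1 h)
      rw [this, measure_empty]
  simp_rw [h1]
  rw [lintegral_indicator measurableSet_Icc, setLIntegral_const, Real.volume_Icc,
    ← ENNReal.ofReal_mul (by positivity)]
  congr 1; field_simp; ring

/-- The extension of a cap is large on the dual parallelogram. -/
lemma le_norm_intervalExtension_capIndicator {Ψ φ : ℝ → ℝ} {K : ℝ} (hK : 0 < K)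
    (hΨ : ∀ x, HasDerivAt Ψ (φ x) x)
    (hup : ∀ ξ ∈ Set.Icc (-1 : ℝ) 1, ∀ η ∈ Set.Icc (-1 : ℝ) 1, |φ ξ - φ η| ≤ K * |ξ - η|)
    {δ : ℝ} (hδ : 0 < δ) (hδ1 : δ ≤ 1) {x : ℝ × ℝ}
    (hx : x ∈ dualRegion (1 / (2 * Real.pi * (1 + K))) (φ 0) δ) :
    δ ≤ ‖intervalExtension Ψ (capIndicator δ) x‖ := by
  set c : ℝ := 1 / (2 * Real.pi * (1 + K)) with hc
  have hpi := Real.pi_pos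
  have hc0 : 0 < c := by positivity
  have hΨc : Continuous Ψ := continuous_iff_continuousAt.2 fun x => (hΨ x).continuousAt
  obtain ⟨hx1, hx2⟩ := hx
  -- The phase without its constant term. The two conditions of the dual region bound the linear
  -- part by c and the Taylor remainder by cK. As 2π(c + cK) = 1, the angle is at most 1 and its
  -- cosine at least 1/2 on a cap of length 2δ.
  set θ : ℝ → ℝ := fun ξ => (x.1 + x.2 * φ 0) * ξ + x.2 * (Ψ ξ - Ψ 0 - φ 0 * ξ) with hθ
  have hrem : ∀ ξ ∈ Set.Icc (-δ) δ, |Ψ ξ - Ψ 0 - φ 0 * ξ| ≤ K * δ ^ 2 := by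
    intro ξ hξ
    have hd : ∀ t, HasDerivAt (fun t => Ψ t - φ 0 * t) (φ t - φ 0) t := fun t => by
      have := (hΨ t).sub ((hasDerivAt_id t).const_mul (φ 0))
      rw [mul_one] at this
      exact this
    have h1 := (convex_Icc (-δ) δ).norm_image_sub_le_of_norm_hasDerivWithin_le
      (fun t _ => (hd t).hasDerivWithinAt) (C := K * δ) (fun t ht => by
        refine (hup t ⟨by linarith [ht.1], by linarith [ht.2]⟩ 0 (by norm_num)).trans ?_
        rw [sub_zero]
        gcongr
        exact abs_le.2 ht) (x := 0) (y := ξ) ⟨by linarith, hδ.le⟩ hξ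
    rw [Real.norm_eq_abs, Real.norm_eq_abs] at h1
    have h2 : |ξ - 0| ≤ δ := by rw [sub_zero]; exact abs_le.2 hξ
    calc |Ψ ξ - Ψ 0 - φ 0 * ξ| = |Ψ ξ - φ 0 * ξ - (Ψ 0 - φ 0 * 0)| := by congr 1; ring
      _ ≤ K * δ * |ξ - 0| := h1
      _ ≤ K * δ * δ := by gcongr
      _ = _ := by ring
  have hθb : ∀ ξ ∈ Set.Icc (-δ) δ, |2 * Real.pi * θ ξ| ≤ 1 := by
    intro ξ hξ
    have h1 : |θ ξ| ≤ c + c * K := by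
      refine (abs_add_le _ _).trans (add_le_add ?_ ?_)
      · rw [abs_mul]
        calc _ ≤ c / δ * δ := by
              gcongr
              exact abs_le.2 hξ
          _ = c := by field_simp
      · rw [abs_mul]
        calc _ ≤ c / δ ^ 2 * (K * δ ^ 2) := by
              gcongr
              exact hrem ξ hξ
          _ = c * K := by field_simp
    rw [abs_mul, abs_of_pos (by positivity)]
    calc _ ≤ 2 * Real.pi * (c + c * K) := by gcongr
      _ = 1 := by rw [hc]; field_simp
  have hE : intervalExtension Ψ (capIndicator δ) x =
      unitPhase (x.2 * Ψ 0) * ∫ ξ in Set.Icc (-δ) δ, unitPhase (θ ξ) := by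
    unfold intervalExtension capIndicator
    have h1 : ∀ ξ, (Set.Icc (-δ) δ).indicator (fun _ => (1 : ℂ)) ξ *
        unitPhase (x.1 * ξ + x.2 * Ψ ξ) =
        (Set.Icc (-δ) δ).indicator (fun ξ => unitPhase (x.1 * ξ + x.2 * Ψ ξ)) ξ := by
      intro ξ
      by_cases h : ξ ∈ Set.Icc (-δ) δ <;> simp [Set.indicator, h]
    simp_rw [h1]
    rw [setIntegral_indicator measurableSet_Icc,
      Set.inter_eq_right.2 (Set.Icc_subset_Icc (by linarith) hδ1), ← integral_const_mul]
    congr 1; ext ξ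
    rw [← unitPhase_add]
    congr 1; simp only [hθ]; ring
  have hθc : Continuous θ := by fun_prop
  have hint : IntegrableOn (fun ξ => unitPhase (θ ξ)) (Set.Icc (-δ) δ) :=
    (Continuous.continuousOn (by fun_prop)).integrableOn_Icc
  rw [hE, norm_mul, norm_unitPhase, one_mul]
  refine le_trans ?_ (Complex.re_le_norm _)
  rw [← RCLike.re_eq_complex_re, ← integral_re hint]
  have h2 : ∫ _ξ in Set.Icc (-δ) δ, (1 / 2 : ℝ) = δ := by
    rw [setIntegral_const, Measure.real, Real.volume_Icc, ENNReal.toReal_ofReal (by linarith)]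
    simp only [smul_eq_mul]; ring
  conv_lhs => rw [← h2]
  refine setIntegral_mono_on (continuous_const.continuousOn.integrableOn_Icc) hint.re
    measurableSet_Icc fun ξ hξ => ?_
  rw [RCLike.re_eq_complex_re, re_unitPhase]
  have h3 : (2 * Real.pi * θ ξ) ^ 2 ≤ 1 := (sq_le_one_iff_abs_le_one _).2 (hθb ξ hξ)
  have h4 : 1 - (2 * Real.pi * θ ξ) ^ 2 / 2 ≤ Real.cos (2 * Real.pi * θ ξ) :=
    Real.one_sub_sq_div_two_le_cos
  linarith

/-- The hypothesis rearranges to c ≤ Cδ^e with e = b(3/b + 1/a - 1). If e were positive, δ → 0 would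
contradict c > 0. -/
lemma three_div_add_one_div_le_one_of_scaling {a b c C : ℝ} (ha : 0 < a) (hb : 0 < b) (hc : 0 < c)
    (h : ∀ δ : ℝ, 0 < δ → δ ≤ 1 → δ ^ b * (c / δ ^ 3) ≤ C * δ ^ (b / a)) :
    3 / b + 1 / a ≤ 1 := by
  by_contra hne
  rw [not_le] at hne
  set e : ℝ := b / a + 3 - b with he
  have he0 : 0 < e := by
    have : e = b * (3 / b + 1 / a - 1) := by rw [he]; field_simp; ring
    rw [this]; exact mul_pos hb (by linarith)
  have h1 : ∀ δ : ℝ, 0 < δ → δ ≤ 1 → c ≤ C * δ ^ e := by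
    intro δ hδ hδ1
    have h2 := h δ hδ hδ1
    have h3 : δ ^ e = δ ^ (b / a) * δ ^ 3 / δ ^ b := by
      rw [he, Real.rpow_sub hδ, Real.rpow_add hδ]; norm_cast
    have h4 : 0 < δ ^ b := by positivity
    rw [h3, ← mul_div_assoc, le_div_iff₀ h4, ← mul_assoc]
    have h5 : δ ^ b * (c / δ ^ 3) * δ ^ 3 ≤ C * δ ^ (b / a) * δ ^ 3 := by gcongr
    calc c * δ ^ b = δ ^ b * (c / δ ^ 3) * δ ^ 3 := by field_simp
      _ ≤ _ := h5
  have hlim : Filter.Tendsto (fun n : ℕ => C * (1 / ((n : ℝ) + 1)) ^ e) Filter.atTop (nhds 0) := by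
    have h2 := (tendsto_one_div_add_atTop_nhds_zero_nat (𝕜 := ℝ)).rpow_const (p := e)
      (Or.inr he0.le)
    rw [Real.zero_rpow he0.ne'] at h2
    simpa using h2.const_mul C
  have := ge_of_tendsto' hlim fun n => h1 (1 / ((n : ℝ) + 1)) (by positivity) (by
    rw [div_le_one (by positivity)]; linarith [n.cast_nonneg (α := ℝ)])
  linarith

/-- Necessity of the scaling condition, by testing on caps. -/
lemma three_div_add_one_div_le_one_of_bound {Ψ φ : ℝ → ℝ} {K : ℝ} (hK : 0 < K)
    (hΨ : ∀ x, HasDerivAt Ψ (φ x) x)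
    (hup : ∀ ξ ∈ Set.Icc (-1 : ℝ) 1, ∀ η ∈ Set.Icc (-1 : ℝ) 1, |φ ξ - φ η| ≤ K * |ξ - η|)
    {p' q' : ℝ≥0∞} (hp : 4 < p') (hq : 1 ≤ q') {C : ℝ≥0}
    (hC : ∀ g : ℝ → ℂ, MemLp g q' intervalMeasure →
      eLpNorm (intervalExtension Ψ g) p' volume ≤ C * eLpNorm g q' intervalMeasure) :
    3 / p' + 1 / q' ≤ 1 := by
  rcases eq_or_ne p' ⊤ with rfl | hptop
  · simpa using hq
  have hp0 : p' ≠ 0 := (pos_of_gt hp).ne'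
  set b := p'.toReal with hb
  have hpb : p' = ENNReal.ofReal b := (ENNReal.ofReal_toReal hptop).symm
  have hb4 : 4 < b := by simpa using (ENNReal.toReal_lt_toReal (by norm_num) hptop).2 hp
  have hb0 : 0 < b := by linarith
  rcases eq_or_ne q' ⊤ with rfl | hqtop
  -- For q' = ∞ the condition reads 3/p' ≤ 1 and already follows from p' > 4, so no caps are needed.
  · rw [ENNReal.div_top, add_zero]
    refine ENNReal.div_le_of_le_mul ?_
    rw [one_mul]
    exact le_trans (by norm_num) hp.le
  have hq0 : q' ≠ 0 := (zero_lt_one.trans_le hq).ne'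
  set a := q'.toReal with ha
  have hqa : q' = ENNReal.ofReal a := (ENNReal.ofReal_toReal hqtop).symm
  have ha1 : 1 ≤ a := by simpa using (ENNReal.toReal_le_toReal (by norm_num) hqtop).2 hq
  have ha0 : 0 < a := by linarith
  set c : ℝ := 1 / (2 * Real.pi * (1 + K)) with hc
  have hpi := Real.pi_pos
  have hc0 : 0 < c := by positivity
  have hreal : 3 / b + 1 / a ≤ 1 := by
    -- Here 4c²/δ³ is the area of the dual region, and C^b·2^(b/a)·δ^(b/a) is the b-th power of
    -- C(2δ)^(1/a).
    refine three_div_add_one_div_le_one_of_scaling ha0 hb0 (c := 4 * c ^ 2)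
      (C := (C : ℝ) ^ b * 2 ^ (b / a)) (by positivity) fun δ hδ hδ1 => ?_
    have hmem : MemLp (capIndicator δ) q' intervalMeasure := by
      refine memLp_indicator_const q' measurableSet_Icc 1 (Or.inr ?_)
      exact ((Measure.restrict_apply_le _ _).trans_lt (by simp)).ne
    have hnorm : eLpNorm (capIndicator δ) q' intervalMeasure = ENNReal.ofReal (2 * δ) ^ (1 / a) := by
      unfold capIndicator
      rw [eLpNorm_indicator_const measurableSet_Icc hq0 hqtop, Measure.restrict_apply measurableSet_Icc,
        Set.inter_eq_left.2 (Set.Icc_subset_Icc (by linarith) hδ1), Real.volume_Icc, ← ha]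
      rw [show δ - -δ = 2 * δ by ring]; simp
    have h1 := hC _ hmem
    rw [hnorm, eLpNorm_eq_lintegral_rpow_enorm_toReal hp0 hptop, ← hb] at h1
    have h2 := ENNReal.rpow_le_rpow h1 hb0.le
    rw [← ENNReal.rpow_mul, one_div_mul_cancel hb0.ne', ENNReal.rpow_one,
      ENNReal.mul_rpow_of_nonneg _ _ hb0.le, ← ENNReal.rpow_mul] at h2
    have h3 : ENNReal.ofReal (δ ^ b * (4 * c ^ 2 / δ ^ 3)) ≤
        ∫⁻ x, ‖intervalExtension Ψ (capIndicator δ) x‖ₑ ^ b := by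
      refine le_trans ?_ (setLIntegral_le_lintegral (dualRegion c (φ 0) δ) _)
      have h4 : ∫⁻ _x in dualRegion c (φ 0) δ, ENNReal.ofReal (δ ^ b) ≤
          ∫⁻ x in dualRegion c (φ 0) δ, ‖intervalExtension Ψ (capIndicator δ) x‖ₑ ^ b := by
        refine setLIntegral_mono' (measurableSet_dualRegion _ _ _) fun x hx => ?_
        rw [← ENNReal.ofReal_rpow_of_pos hδ]
        gcongr
        rw [← ofReal_norm]
        exact ENNReal.ofReal_le_ofReal
          (le_norm_intervalExtension_capIndicator hK hΨ hup hδ hδ1 hx)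
      refine le_trans (le_of_eq ?_) h4
      rw [setLIntegral_const, volume_dualRegion hc0 hδ, ← ENNReal.ofReal_mul (by positivity)]
    have h5 := h3.trans h2
    rw [show (1 / a) * b = b / a by ring, ENNReal.ofReal_rpow_of_pos (by positivity),
      ← ENNReal.ofReal_coe_nnreal, ENNReal.ofReal_rpow_of_nonneg C.coe_nonneg hb0.le,
      ← ENNReal.ofReal_mul (by positivity), ENNReal.ofReal_le_ofReal_iff (by positivity),
      Real.mul_rpow (by norm_num) hδ.le, ← mul_assoc] at h5
    exact h5
  rw [hpb, hqa, ← ENNReal.ofReal_ofNat (n := 3), ← ENNReal.ofReal_one,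
    ← ENNReal.ofReal_div_of_pos hb0, ← ENNReal.ofReal_div_of_pos ha0,
    ← ENNReal.ofReal_add (by positivity) (by positivity)]
  exact ENNReal.ofReal_le_ofReal hreal

/-! ### The equivalence -/

/-- The necessary conditions for an extension estimate. -/
theorem ExtensionEstimate.necessary {p' q' : ℝ≥0∞} (hp : 1 ≤ p') (hq : 1 ≤ q') {v : ℝ} {ψ : ℝ → ℝ}
    (hψ : CurvatureBoundedBelow v ψ) (h : ExtensionEstimate ψ q' p') :
    4 < p' ∧ 3 / p' + 1 / q' ≤ 1 := by
  obtain ⟨C, hC⟩ := h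
  rw [extensionBound_iff hψ.continuousOn] at hC
  obtain ⟨Ψ, φ, hφ, hΨ, heq, -, K, hK, hup⟩ := hψ.exists_extension
  simp_rw [intervalExtension_congr_phase heq] at hC
  have h4 : 4 < p' := by
    refine four_lt_of_eLpNorm_intervalExtension_one hφ hΨ hp ?_
    have hmem : MemLp (fun _ : ℝ => (1 : ℂ)) q' intervalMeasure := memLp_const 1
    exact ne_top_of_le_ne_top (ENNReal.mul_ne_top ENNReal.coe_ne_top hmem.2.ne) (hC _ hmem)
  exact ⟨h4, three_div_add_one_div_le_one_of_bound hK hΨ hup h4 hq hC⟩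

end

theorem mainTheorem5 (p q p' q' : ℝ≥0∞)
    (hp : ENNReal.HolderConjugate p p') (hq : ENNReal.HolderConjugate q q')
    (v : ℝ) (hv : 0 < v) :
    (∀ ψ : ℝ → ℝ, CurvatureBoundedBelow v ψ →
      (ExtensionEstimate ψ q' p' ↔ 4 < p' ∧ 3 / p' + 1 / q' ≤ 1)) ∧
    (4 < p' → 3 / p' + 1 / q' ≤ 1 →
      ∃ C : ℝ≥0, ∀ ψ : ℝ → ℝ, CurvatureBoundedBelow v ψ → ExtensionBound ψ q' p' C) := by
  have hp1 : 1 ≤ p' := hp.symm.one_le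
  have hq1 : 1 ≤ q' := hq.symm.one_le
  refine ⟨fun ψ hψ => ⟨fun h => h.necessary hp1 hq1 hψ, fun h => ?_⟩,
    fun h1 h2 => exists_extensionBound hq1 hv h1 h2⟩
  obtain ⟨C, hC⟩ := exists_extensionBound hq1 hv h.1 h.2
  exact ⟨C, hC ψ hψ⟩
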